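/- Let $G=(V,E)$ be a finite simple undirected graph with $n=|V|\ge 1$ vertices, $m=|E|$ edges and maximum degree $\Delta$, and let $\mathrm{OPT}=\max_{\emptyset\ne S\subseteq V}|E(S)|/|S|$ be the maximum density of a subgraph, where $E(S)$ is the set of edges with both endpoints in $S$. Consider the width-reduced dual LP with variables $D$ and $z=(z_{eu})_{e\in E,\,u\in e}$, $$\min D\quad\text{s.t.}\quad \sum_{e\ni u}z_{eu}\le D\ \ \forall u\in V,\qquad z_{eu}+z_{ev}\ge 1\ \ \forall e=uv\in E,\qquad 0\le z_{eu}\le 1\ \ \forall e\in E,\ u\in e .$$ The optimal value $D^*$ of this LP is attained and equals $\mathrm{OPT}$. Moreover, there is a universal constant $c\in\mathbb N$ such that for every such $G$ and every $\epsilon\in(0,1)$ the algorithm described below (in exact real arithmetic) outputs $z\in[0,1]^{2m}$ and $\tilde D=\max_{u\in V}\sum_{e\ni u}z_{eu}$ with $$z_{eu}+z_{ev}\ge 1\ \text{ for all } e=uv\in E,\qquad (1-\epsilon)\,D^*\le\tilde D\le(1+\epsilon)\,D^*,\qquad D^*=\mathrm{OPT}.$$ The algorithm. Let $C(D)=\{z\in[0,1]^{2m}:\sum_{e\ni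 u}z_{eu}\le D\ \forall u\}$, let $\Delta_m$ be the probability simplex in $\mathbb R^m$, let $(Bz)_e=z_{eu}+z_{ev}$ for $e=uv$, $A(z,y)=(B^Ty,-Bz)$, and $\phi(z,y)=6\sqrt3\big(\sum_{e=uv}(y_e(z_{eu}^2+z_{ev}^2)+6y_e\log y_e)-2\big)$. Put $T=\lceil c\log(m+1)/\epsilon\rceil$ and $K=\lceil c\log((m+1)/\epsilon)\rceil$. * Oracle: for $x=(s,r)\in\mathbb R^{2m}\times\mathbb R^m$, $\Phi(x)$ is the result of $K+1$ rounds of alternating exact minimization of $H(z,y)=\phi(z,y)-\langle z,s\rangle-\langle y,r\rangle$, started at $z=0$; each round first minimizes over $y\in\Delta_m$ and then over $z\in C(D)$. The minimizer in $y$ is computed as $y_e\propto\exp\big(-\tfrac16(z_{eu}^2+z_{ev}^2-\tfrac{r_e}{6\sqrt3})\big)$, and the minimizer in $z$ as $z_{eu}=\max\{0,\min\{1,(\tfrac{s_{eu}}{6\sqrt3}-\lambda_u)/(2y_e)\}\}$, where for each vertex $u$ the multiplier $\lambda_u\ge0$ of the constraint $\sum_{e\ni u}z_{eu}\le D$ is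 found by linear interpolation between consecutive breakpoints. * Saddle point solver for $\min_{z\in C(D),\,y\in\Delta_m}\max_{\bar z\in C(D),\,\bar y\in\Delta_m}\ y^TB\bar z-\bar y^TBz$: start at $w=(0,(\tfrac1m,\dots,\tfrac1m))$, perform $T$ updates $w\leftarrow w+\Phi(Aw+2A\Phi(Aw))$, and return the $z$-part of $w$ divided by $T$. * Binary search over $D$: start with the interval $[0,\Delta]$ and $z\equiv1$. In each of $K$ steps, run the solver at the midpoint $D$ of the current interval. If its output satisfies $z_{eu}+z_{ev}\ge1-\epsilon/3$ for all $e=uv\in E$, keep this output and the lower half of the interval; otherwise declare the problem for $D$ infeasible and keep the upper half. * Output: replace the last kept $z$ by $z_{eu}/(z_{eu}+z_{ev})$, and output it together with its maximum load $\tilde D$. -/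

import Mathlib

/-! ## Graphs, densities and the width-reduced dual LP

A dart `d` of `G` is an ordered pair `(u, v)` of adjacent vertices.  It stands for the pair
`(e, u)` of the edge `e = uv` and its endpoint `u = d.fst`, so that `z d` is `z_{eu}`,
`z d.symm` is `z_{ev}`, and `G.Dart → R` is `R^{2m}`. -/

namespace DensestDual

section Problem

variable {V : Type*} [Fintype V] [DecidableEq V]

/-- The load `∑_{e ∋ u} z_{eu}` of the vertex `u`. -/
def load {R : Type*} [AddCommMonoid R] (G : SimpleGraph V) [DecidableRel G.Adj]
    (z : G.Dart → R) (u : V) : R :=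
  ∑ d : G.Dart with d.fst = u, z d

/-- `(D, z)` is feasible for the width-reduced dual LP with `q = 1`. -/
def LPFeasible (G : SimpleGraph V) [DecidableRel G.Adj] (z : G.Dart → ℝ) (D : ℝ) : Prop :=
  (∀ u, load G z u ≤ D) ∧ (∀ d : G.Dart, 1 ≤ z d + z d.symm) ∧ ∀ d, 0 ≤ z d ∧ z d ≤ 1

/-- The number `|E(S)|` of edges of `G` with both endpoints in `S`. -/
def inducedEdgeCount (G : SimpleGraph V) [DecidableRel G.Adj] (S : Finset V) : ℕ :=
  (G.edgeFinset.filter fun e => ∀ u ∈ e, u ∈ S).card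

/-- The set of all densities `|E(S)| / |S|`, for `S` a nonempty set of vertices. -/
def densities (G : SimpleGraph V) [DecidableRel G.Adj] : Set ℝ :=
  {ρ | ∃ S : Finset V, S.Nonempty ∧ ρ = (inducedEdgeCount G S : ℝ) / (S.card : ℝ)}

end Problem

/-! ## The algorithm

The algorithm works in exact real arithmetic.  To make visible that it consists of nothing but
arithmetic operations, comparisons, roundings and evaluations of `exp`, `log` and square root, it is
written over an arbitrary type `R` of numbers that has these operations; none of the definitions
that make up the algorithm is `noncomputable`.  The theorem is about `R = ℝ`. -/

/-- The elementary functions that the algorithm evaluates. -/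
class ElementaryFunctions (R : Type*) where
  exp : R → R
  log : R → R
  sqrt : R → R

noncomputable instance : ElementaryFunctions ℝ where
  exp := Real.exp
  log := Real.log
  sqrt := Real.sqrt

section Algorithm

variable {V : Type*} [Fintype V] [DecidableEq V] (G : SimpleGraph V) [DecidableRel G.Adj]
variable {R : Type*} [Field R] [LinearOrder R] [ElementaryFunctions R]

/-- Pairs `w = (z, y)` with `z ∈ R^{2m}` and `y ∈ R^m`. -/
abbrev Point (R : Type*) : Type _ := (G.Dart → R) × (G.edgeSet → R)

/-- The map `A (z, y) = (Bᵀ y, - B z)`, where `(B z)_e = z_{eu} + z_{ev}` for `e = uv`. -/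
def saddleMap (w : Point G R) : Point G R :=
  (fun d => w.2 ⟨d.edge, d.edge_mem⟩, fun e => - ∑ d : G.Dart with d.edge = e.1, w.1 d)

/-- The scaling factor `6√3` of the regularizer
`φ(z, y) = 6√3 (∑_e (y_e (z_{eu}² + z_{ev}²) + 6 y_e log y_e) - 2)`. -/
def regScale : R := 6 * ElementaryFunctions.sqrt 3

/-- The minimizer over the simplex `Δ_m` of `y ↦ φ(z, y) - ⟨z, s⟩ - ⟨y, r⟩`: it is proportional to
`exp (- (z_{eu}² + z_{ev}² - r_e / (6√3)) / 6)`. -/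
def yStep (r : G.edgeSet → R) (z : G.Dart → R) : G.edgeSet → R :=
  let g : G.edgeSet → R := fun e =>
    ElementaryFunctions.exp (-((∑ d : G.Dart with d.edge = e.1, z d ^ 2) - r e / regScale) / 6)
  fun e => g e / ∑ e', g e'

/-- `z_{eu}(lam) = max {0, min {1, (s_{eu} / (6√3) - lam) / (2 y_e)}}`. -/
def clampedResponse (y : G.edgeSet → R) (s : G.Dart → R) (lam : R) : G.Dart → R := fun d =>
  max 0 (min 1 ((s d / regScale - lam) / (2 * y ⟨d.edge, d.edge_mem⟩)))

/-- Zero and the positive points at which the slope of `lam ↦ ∑_{e ∋ u} z_{eu}(lam)` can change. -/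
def breakpoints (y : G.edgeSet → R) (s : G.Dart → R) (u : V) : Finset R :=
  let D : Finset G.Dart := Finset.univ.filter fun d => d.fst = u
  insert 0 ((D.image (fun d => s d / regScale) ∪
    D.image (fun d => s d / regScale - 2 * y ⟨d.edge, d.edge_mem⟩)).filter fun p => 0 < p)

/-- The Lagrange multiplier of the constraint `∑_{e ∋ u} z_{eu} ≤ D`: zero if `z(0)` satisfies the
constraint, and otherwise a solution of `∑_{e ∋ u} z_{eu}(lam) = D`, found by linear interpolation
between the two consecutive breakpoints `a < b` between which it lies. -/
def multiplier (D : R) (y : G.edgeSet → R) (s : G.Dart → R) (u : V) : R :=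
  let f : R → R := fun lam => load G (clampedResponse G y s lam) u
  let P : Finset R := breakpoints G y s u
  if f 0 ≤ D then 0
  else
    let a : R := (P.filter fun p => D ≤ f p).fold max 0 id
    let b : R := (P.filter fun p => a < p).fold min (P.fold max 0 id) id
    a + (f a - D) * (b - a) / (f a - f b)

/-- The minimizer of `z ↦ φ(z, y) - ⟨z, s⟩ - ⟨y, r⟩` over
`C(D) = {z ∈ [0,1]^{2m} : ∑_{e ∋ u} z_{eu} ≤ D for all u}`, computed for each vertex separately. -/
def zStep (D : R) (y : G.edgeSet → R) (s : G.Dart → R) : G.Dart → R := fun d =>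
  clampedResponse G y s (multiplier G D y s d.fst) d

/-- One round of alternating minimization for the input `x = (s, r)`: first `y`, then `z`. -/
def alternatingStep (D : R) (x w : Point G R) : Point G R :=
  let y := yStep G x.2 w.1
  (zStep G D y x.1, y)

/-- The oracle `Φ`: the rounds `t = 0, …, K` of alternating minimization, started at `z = 0`
(the initial `y` is irrelevant). -/
def oracle (D : R) (K : ℕ) (x : Point G R) : Point G R :=
  (alternatingStep G D x)^[K + 1] (0, 0)

/-- `Φ̃(x) = Φ(x + 2 A Φ(x))`. -/
def doubleOracle (D : R) (K : ℕ) (x : Point G R) : Point G R :=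
  oracle G D K (x + (2 : R) • saddleMap G (oracle G D K x))

/-- The saddle point solver on the domain `C(D) × Δ_m`: start at `z = 0`, `y = (1/m, …, 1/m)`, make
`T` updates `w ← w + Φ̃(A w)`, and return `z / T`. -/
def saddleSolver (D : R) (T K : ℕ) : G.Dart → R :=
  let w : Point G R := (fun w => w + doubleOracle G D K (saddleMap G w))^[T]
    (0, fun _ => 1 / (G.edgeFinset.card : R))
  fun d => w.1 d / (T : R)

/-- A state of the binary search: a lower end, an upper end, and the last solution accepted. -/
structure SearchState (R : Type*) where
  lo : R
  hi : R
  z : G.Dart → R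

/-- One step of the binary search over `D`.  The solution that the saddle point solver finds for the
midpoint is accepted if `z_{eu} + z_{ev} ≥ 1 - ε'` for all edges `e = uv`; otherwise the feasibility
problem for the midpoint is declared infeasible. -/
def searchStep (ε' : R) (T K : ℕ) (σ : SearchState G R) : SearchState G R :=
  let mid : R := (σ.lo + σ.hi) / 2
  let z := saddleSolver G mid T K
  if ∀ d : G.Dart, 1 - ε' ≤ z d + z d.symm then ⟨σ.lo, mid, z⟩ else ⟨mid, σ.hi, σ.z⟩

/-- The binary search with `N` steps, started with the interval `[0, Δ]` and with `z = 1`. -/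
def binarySearch (ε' : R) (T K N : ℕ) : G.Dart → R :=
  ((searchStep G ε' T K)^[N] ⟨0, (G.maxDegree : R), fun _ => 1⟩).z

/-- The rescaled solution `z_{eu} / (z_{eu} + z_{ev})`. -/
def normalize (z : G.Dart → R) : G.Dart → R := fun d => z d / (z d + z d.symm)

/-- The number `⌈c log(m+1) / ε⌉` of updates of the saddle point solver. -/
def outerIterations [FloorSemiring R] (c : ℕ) (ε : R) : ℕ :=
  ⌈(c : R) * ElementaryFunctions.log ((G.edgeFinset.card : R) + 1) / ε⌉₊

/-- The number `⌈c log((m+1) / ε)⌉` of rounds in the oracle and of steps of the binary search. -/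
def innerIterations [FloorSemiring R] (c : ℕ) (ε : R) : ℕ :=
  ⌈(c : R) * ElementaryFunctions.log (((G.edgeFinset.card : R) + 1) / ε)⌉₊

/-- The algorithm.  It outputs `z` and the largest load of a vertex under `z`; the natural number `c`
is the constant in the `O(·)` of the iteration counts. -/
def dualAlgorithm [FloorSemiring R] (c : ℕ) (ε : R) : (G.Dart → R) × R :=
  let z := normalize G (binarySearch G (ε / 3) (outerIterations G c ε) (innerIterations G c ε)
    (innerIterations G c ε))
  (z, Finset.univ.fold max 0 (load G z))

end Algorithm

end DensestDual

/-!
The solver is a dual extrapolation scheme for the bilinear form `⟨p, A w⟩`, and its regularizer `φ`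
is only *area convex*: on a triangle `a, b, c` its convexity gap dominates the signed area
`⟨b, A a⟩ + ⟨c, A b⟩ - ⟨c, A a⟩`. Both `φ` and the area are sums over darts of functions of two
variables, so this reduces to one inequality in the plane (`area_le_dartReg_gap`); there one
expands around the centre of the triangle, where the first-order terms cancel and the Bregman
remainders `bregmanProfile` are bounded below by a quadratic form. Area convexity is what is needed
for the potential `max_p (⟨p, A w⟩ - φ(p))` to grow by no more than the error of the oracle in each
update (`dualObjective_update_le`). After `T` updates the potential is still `O(log m)`, because `φ`
has range `O(log m)`; divided by `T` this is `O(ε)`. Testing the resulting bound against a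
feasible `z` and the point mass of one edge shows that the output almost covers this edge
(`saddleSolver_covers`).

The oracle converges linearly (`dualObjective_gap_zStep_le`). Around `(z, y)` with the Gibbs weights
`y`, the linear term in `y` vanishes, and the Bregman divergence to a competitor `(z', y')` is at
least a third of `∑ y (z' - z)²`, which is the second-order term in `z`. Moving `z` by a third of
the way to `z'` therefore removes a third of the gap, and the exact minimizer in `z` does at least as
well. That `zStep` is this minimizer is Lagrangian duality, with a multiplier that satisfies
complementary slackness (`multiplier_spec`).

The optimal value of the linear program is the maximal density: weak duality is a double count, and
equality holds for a fractional orientation that minimizes the sum of the squared loads. In it no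
load can be moved from a vertex to one of smaller load, so all edges that contribute to a vertex of
maximal load lie between such vertices, and the maximal load is the density of the set of these
vertices (`exists_lpFeasible_mem_densities`).
-/

set_option linter.unusedSectionVars false

namespace DensestDual

open InformationTheory

/-! ### Scalar inequalities -/

lemma half_sq_le_klFun {r : ℝ} (h0 : 0 ≤ r) (h1 : r ≤ 1) : (r - 1) ^ 2 / 2 ≤ klFun r := by
  rcases h0.eq_or_lt with rfl | hr
  · norm_num [klFun]
  -- With `u = -log r ≥ 0` the claim is `u ≤ sinh u`.
  have hu : 0 ≤ -Real.log r := by linarith [Real.log_nonpos h0 h1]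
  have h := Real.self_le_sinh_iff.2 hu
  rw [Real.sinh_neg, Real.sinh_log hr] at h
  have h2 : r * (r - r⁻¹) ≤ r * (2 * Real.log r) := mul_le_mul_of_nonneg_left (by linarith) h0
  have h3 : r * r⁻¹ = 1 := mul_inv_cancel₀ hr.ne'
  rw [klFun_apply]
  nlinarith

lemma sq_div_add_one_le_klFun {r : ℝ} (h1 : 1 ≤ r) : (r - 1) ^ 2 / (r + 1) ≤ klFun r := by
  have h := Real.le_log_one_add_of_nonneg (sub_nonneg.2 h1)
  rw [show 1 + (r - 1) = r by ring, show r - 1 + 2 = r + 1 by ring,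
    div_le_iff₀ (by linarith)] at h
  rw [klFun_apply, div_le_iff₀ (by linarith)]
  nlinarith [mul_le_mul_of_nonneg_left h (show 0 ≤ r by linarith)]

/-- The Bregman divergence of `(z, y) ↦ y z² + 3 y log y` from `(z, y)` to `(z + δ, r y)`,
divided by `y`. -/
noncomputable def bregmanProfile (r z δ : ℝ) : ℝ :=
  r * δ ^ 2 + 2 * (r - 1) * (z * δ) + 3 * klFun r

/-- A common lower bound for `bregmanProfile`.  The hypotheses on `θ` and `β` say that a quadratic
form in `(δ, r - 1)` is nonnegative, for `r ≤ 1` and for `r ≥ 1`. -/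
lemma le_bregmanProfile {r z δ θ β : ℝ} (hr : 0 ≤ r) (hz : z ∈ Set.Icc (0 : ℝ) 1)
    (hzδ : z + δ ∈ Set.Icc (0 : ℝ) 1) (hθ : θ ≤ 1) (hβ : β ≤ 3 / 2)
    (hlow : 1 ≤ (1 - θ) * (3 / 2 - β))
    (hhigh : 1 ≤ r → 1 ≤ (r - θ) * (3 / (r + 1) - β)) :
    θ * δ ^ 2 + β * (r - 1) ^ 2 ≤ bregmanProfile r z δ := by
  obtain ⟨hz0, hz1⟩ := hz
  obtain ⟨hd0, hd1⟩ := hzδ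
  -- A quadratic form `A x² - 2 x t + C t²` with `A C ≥ 1` is nonnegative.
  have key : ∀ A C x t : ℝ, 0 < A → 1 ≤ A * C → 0 ≤ A * x ^ 2 - 2 * x * t + C * t ^ 2 := by
    intro A C x t hA h
    have : 0 ≤ A * (A * x ^ 2 - 2 * x * t + C * t ^ 2) := by
      nlinarith [sq_nonneg (A * x - t), sq_nonneg t]
    exact nonneg_of_mul_nonneg_right this hA
  unfold bregmanProfile
  rcases le_total r 1 with h1 | h1
  · have hk := half_sq_le_klFun hr h1
    rcases le_total 0 δ with hδ | hδ
    · have hA : 0 < (2 - r) - θ := by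
        rcases hθ.lt_or_eq with h | rfl
        · linarith
        · norm_num at hlow
      -- Here `z δ ≤ (1 - δ) δ` since `z + δ ≤ 1`.
      have h := key ((2 - r) - θ) (3 / 2 - β) δ (1 - r) hA (by nlinarith)
      nlinarith [mul_nonneg (sub_nonneg.2 h1) (mul_nonneg hδ (show 0 ≤ 1 - δ - z by linarith))]
    · have : 0 ≤ (1 - r) * ((-δ) * (z + δ)) :=
        mul_nonneg (sub_nonneg.2 h1) (mul_nonneg (by linarith) hd0)
      nlinarith [mul_nonneg (show 0 ≤ (1 - r) + (1 - θ) by linarith) (sq_nonneg δ),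
        mul_nonneg (sub_nonneg.2 hβ) (sq_nonneg (r - 1))]
  · have hk := sq_div_add_one_le_klFun h1
    have hA : 0 < r - θ := by
      rcases (hθ.trans h1).lt_or_eq with h | h
      · linarith
      · have := hhigh h1
        rw [h] at this
        norm_num at this
    have hzδ' : -(z * δ) ≤ |δ| := by
      have := neg_abs_le δ
      nlinarith [abs_nonneg δ]
    have h := key _ _ |δ| (r - 1) hA (hhigh h1)
    rw [sq_abs] at h
    have e : (3 / (r + 1) - β) * (r - 1) ^ 2 = 3 * ((r - 1) ^ 2 / (r + 1)) - β * (r - 1) ^ 2 := by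
      ring
    rw [e] at h
    nlinarith [mul_le_mul_of_nonneg_left hzδ' (sub_nonneg.2 h1)]

lemma third_sq_le_bregmanProfile {r z δ : ℝ} (hr : 0 ≤ r) (hz : z ∈ Set.Icc (0 : ℝ) 1)
    (hzδ : z + δ ∈ Set.Icc (0 : ℝ) 1) : 1 / 3 * δ ^ 2 ≤ bregmanProfile r z δ := by
  have h := le_bregmanProfile (θ := 1 / 3) (β := 0) hr hz hzδ (by norm_num) (by norm_num)
    (by norm_num) (fun h1 => by
      rw [sub_zero, mul_div_assoc', le_div_iff₀ (by linarith)]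
      linarith)
  linarith

lemma quadratic_le_bregmanProfile {r z δ : ℝ} (hr : 0 ≤ r) (hr3 : r ≤ 3)
    (hz : z ∈ Set.Icc (0 : ℝ) 1) (hzδ : z + δ ∈ Set.Icc (0 : ℝ) 1) :
    1 / 5 * δ ^ 2 + 1 / 4 * (r - 1) ^ 2 ≤ bregmanProfile r z δ := by
  refine le_bregmanProfile (θ := 1 / 5) (β := 1 / 4) hr hz hzδ (by norm_num) (by norm_num)
    (by norm_num) (fun h1 => ?_)
  rw [div_sub' (by linarith), mul_div_assoc', le_div_iff₀ (by linarith)]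
  nlinarith [mul_nonneg (sub_nonneg.2 h1) (sub_nonneg.2 hr3)]

/-- The contribution of one dart to the unscaled regularizer. -/
noncomputable def dartReg (z y : ℝ) : ℝ := y * z ^ 2 + 3 * (y * Real.log y)

lemma dartReg_eq_linearization_add {z y z' y' : ℝ} (hy : 0 < y) (hy' : 0 ≤ y') :
    dartReg z' y' = dartReg z y + 2 * y * z * (z' - z) + (z ^ 2 + 3 * Real.log y + 3) * (y' - y)
      + y * bregmanProfile (y' / y) z (z' - z) := by
  have h : y' * Real.log (y' / y) = y' * Real.log y' - y' * Real.log y := by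
    rcases hy'.eq_or_lt with rfl | h
    · simp
    · rw [Real.log_div h.ne' hy.ne']; ring
  have e : y * (y' / y) = y' := mul_div_cancel₀ y' hy.ne'
  have : y * bregmanProfile (y' / y) z (z' - z) = (y * (y' / y)) * (z' - z) ^ 2 +
      2 * (y * (y' / y) - y) * (z * (z' - z)) +
      3 * ((y * (y' / y)) * Real.log (y' / y) + y - y * (y' / y)) := by
    unfold bregmanProfile klFun; ring
  rw [this, e, h]
  unfold dartReg
  ring

/-- Area convexity for one dart: the convexity gap of the regularizer on a triangle dominates the
signed area of the triangle. -/
lemma area_le_dartReg_gap {z₁ z₂ z₃ y₁ y₂ y₃ : ℝ}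
    (hz₁ : z₁ ∈ Set.Icc (0 : ℝ) 1) (hz₂ : z₂ ∈ Set.Icc (0 : ℝ) 1) (hz₃ : z₃ ∈ Set.Icc (0 : ℝ) 1)
    (hy₁ : 0 ≤ y₁) (hy₂ : 0 ≤ y₂) (hy₃ : 0 ≤ y₃) :
    2 * ((z₂ * y₁ - y₂ * z₁) + (z₃ * y₂ - y₃ * z₂) - (z₃ * y₁ - y₃ * z₁)) ≤
      6 * √3 * (dartReg z₁ y₁ + dartReg z₂ y₂ + dartReg z₃ y₃ -
        3 * dartReg ((z₁ + z₂ + z₃) / 3) ((y₁ + y₂ + y₃) / 3)) := by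
  rcases (show 0 ≤ (y₁ + y₂ + y₃) / 3 by positivity).eq_or_lt with h | hY
  · obtain rfl : y₁ = 0 := by linarith
    obtain rfl : y₂ = 0 := by linarith
    obtain rfl : y₃ = 0 := by linarith
    simp [dartReg]
  obtain ⟨Y, hYdef⟩ : ∃ Y, Y = (y₁ + y₂ + y₃) / 3 := ⟨_, rfl⟩
  obtain ⟨Z, hZdef⟩ : ∃ Z, Z = (z₁ + z₂ + z₃) / 3 := ⟨_, rfl⟩
  rw [← hYdef] at hY
  rw [← hYdef, ← hZdef]
  obtain ⟨r₁, rfl⟩ : ∃ r, y₁ = Y * r := ⟨y₁ / Y, (mul_div_cancel₀ _ hY.ne').symm⟩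
  obtain ⟨r₂, rfl⟩ : ∃ r, y₂ = Y * r := ⟨y₂ / Y, (mul_div_cancel₀ _ hY.ne').symm⟩
  obtain ⟨r₃, rfl⟩ : ∃ r, y₃ = Y * r := ⟨y₃ / Y, (mul_div_cancel₀ _ hY.ne').symm⟩
  have hr₁ := nonneg_of_mul_nonneg_right hy₁ hY
  have hr₂ := nonneg_of_mul_nonneg_right hy₂ hY
  have hr₃ := nonneg_of_mul_nonneg_right hy₃ hY
  have hsum : r₁ + r₂ + r₃ = 3 := by
    have : Y * (r₁ + r₂ + r₃) = Y * 3 := by linarith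
    exact mul_left_cancel₀ hY.ne' this
  have hZ : Z ∈ Set.Icc (0 : ℝ) 1 := by
    constructor <;> linarith [hz₁.1, hz₁.2, hz₂.1, hz₂.2, hz₃.1, hz₃.2]
  have bound : ∀ z r, z ∈ Set.Icc (0 : ℝ) 1 → 0 ≤ r → r ≤ 3 →
      Y * (1 / 5 * (z - Z) ^ 2 + 1 / 4 * (r - 1) ^ 2) + dartReg Z Y + 2 * Y * Z * (z - Z) +
        (Z ^ 2 + 3 * Real.log Y + 3) * (Y * r - Y) ≤ dartReg z (Y * r) := by
    intro z r hz hr hr3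
    rw [dartReg_eq_linearization_add (z := Z) hY (mul_nonneg hY.le hr), mul_div_cancel_left₀ r hY.ne']
    have := mul_le_mul_of_nonneg_left
      (quadratic_le_bregmanProfile (δ := z - Z) hr hr3 hZ (by simpa using hz)) hY.le
    linarith
  have b₁ := bound z₁ r₁ hz₁ hr₁ (by linarith)
  have b₂ := bound z₂ r₂ hz₂ hr₂ (by linarith)
  have b₃ := bound z₃ r₃ hz₃ hr₃ (by linarith)
  set q := 1 / 5 * ((z₁ - Z) ^ 2 + (z₂ - Z) ^ 2 + (z₃ - Z) ^ 2) +
    1 / 4 * ((r₁ - 1) ^ 2 + (r₂ - 1) ^ 2 + (r₃ - 1) ^ 2) with hq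
  have hgap : Y * q ≤ dartReg z₁ (Y * r₁) + dartReg z₂ (Y * r₂) + dartReg z₃ (Y * r₃) -
      3 * dartReg Z Y := by
    have e₁ : 2 * Y * Z * (z₁ - Z) + 2 * Y * Z * (z₂ - Z) + 2 * Y * Z * (z₃ - Z) = 0 := by
      rw [hZdef]; ring
    have e₂ : (Z ^ 2 + 3 * Real.log Y + 3) * (Y * r₁ - Y) +
        (Z ^ 2 + 3 * Real.log Y + 3) * (Y * r₂ - Y) +
        (Z ^ 2 + 3 * Real.log Y + 3) * (Y * r₃ - Y) = 0 := by
      linear_combination (Z ^ 2 + 3 * Real.log Y + 3) * Y * hsum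
    have e₃ : Y * q = Y * (1 / 5 * (z₁ - Z) ^ 2 + 1 / 4 * (r₁ - 1) ^ 2) +
        Y * (1 / 5 * (z₂ - Z) ^ 2 + 1 / 4 * (r₂ - 1) ^ 2) +
        Y * (1 / 5 * (z₃ - Z) ^ 2 + 1 / 4 * (r₃ - 1) ^ 2) := by
      rw [hq]; ring
    linarith
  have hq0 : 0 ≤ q := by positivity
  have hsqrt : 3 / 2 ≤ √3 := Real.le_sqrt_of_sq_le (by norm_num)
  -- Around the mean the claim is a positive definite quadratic form in two of the three points.
  have harea : (z₂ * r₁ - r₂ * z₁) + (z₃ * r₂ - r₃ * z₂) - (z₃ * r₁ - r₃ * z₁) ≤ 9 / 2 * q := by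
    have hz : z₃ = 3 * Z - z₁ - z₂ := by rw [hZdef]; ring
    have hr : r₃ = 3 - r₁ - r₂ := by linarith
    have e : 9 / 2 * q - ((z₂ * r₁ - r₂ * z₁) + (z₃ * r₂ - r₃ * z₂) - (z₃ * r₁ - r₃ * z₁)) =
        27 / 20 * ((z₂ - Z) - 10 / 9 * ((r₁ - 1) + (r₂ - 1) / 2)) ^ 2 +
        9 / 5 * ((z₁ - Z) + (z₂ - Z) / 2 + 5 / 6 * (r₂ - 1)) ^ 2 +
        7 / 12 * ((r₁ - 1) + (r₂ - 1) / 2) ^ 2 + 7 / 16 * (r₂ - 1) ^ 2 := by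
      rw [hq, hz, hr]; ring
    have : 0 ≤ 9 / 2 * q -
        ((z₂ * r₁ - r₂ * z₁) + (z₃ * r₂ - r₃ * z₂) - (z₃ * r₁ - r₃ * z₁)) := by
      rw [e]; positivity
    linarith
  calc 2 * ((z₂ * (Y * r₁) - Y * r₂ * z₁) + (z₃ * (Y * r₂) - Y * r₃ * z₂) -
        (z₃ * (Y * r₁) - Y * r₃ * z₁))
      = 2 * Y * ((z₂ * r₁ - r₂ * z₁) + (z₃ * r₂ - r₃ * z₂) - (z₃ * r₁ - r₃ * z₁)) := by ring
    _ ≤ 2 * Y * (9 / 2 * q) := by gcongr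
    _ = 6 * (3 / 2) * (Y * q) := by ring
    _ ≤ 6 * √3 * (Y * q) := by gcongr
    _ ≤ _ := by gcongr

/-! ### Darts, the domain and the regularizer -/

section Domain

variable {V : Type*} [Fintype V] [DecidableEq V] {G : SimpleGraph V} [DecidableRel G.Adj]

/-- The edge underlying a dart, as an element of the index type of `y`. -/
def edgeOf (d : G.Dart) : G.edgeSet := ⟨d.edge, d.edge_mem⟩

lemma edgeOf_surjective (e : G.edgeSet) : ∃ d : G.Dart, edgeOf d = e := by
  obtain ⟨⟨u, v⟩, h⟩ := e
  exact ⟨⟨(u, v), h⟩, rfl⟩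

lemma sum_darts_of_edge (f : G.Dart → ℝ) (d : G.Dart) :
    ∑ d' : G.Dart with d'.edge = d.edge, f d' = f d + f d.symm := by
  rw [d.edge_fiber, Finset.sum_pair d.symm_ne.symm]

lemma sum_edges_sum_darts (f : G.Dart → ℝ) :
    ∑ e : G.edgeSet, ∑ d : G.Dart with d.edge = e.1, f d = ∑ d, f d := by
  rw [← Finset.sum_fiberwise Finset.univ (edgeOf (G := G)) f]
  exact Finset.sum_congr rfl fun e _ => Finset.sum_congr (by ext d; simp [edgeOf, Subtype.ext_iff])
    fun _ _ => rfl

lemma sum_edges_mul_sum_darts (y : G.edgeSet → ℝ) (f : G.Dart → ℝ) :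
    ∑ e : G.edgeSet, y e * ∑ d : G.Dart with d.edge = e.1, f d = ∑ d, y (edgeOf d) * f d := by
  rw [← sum_edges_sum_darts]
  refine Finset.sum_congr rfl fun e _ => ?_
  rw [Finset.mul_sum]
  refine Finset.sum_congr rfl fun d hd => ?_
  rw [show edgeOf d = e from Subtype.ext (Finset.mem_filter.1 hd).2]

lemma card_darts_of_edge (e : G.edgeSet) :
    ∑ d : G.Dart with d.edge = e.1, (1 : ℝ) = 2 := by
  obtain ⟨d, rfl⟩ := edgeOf_surjective e
  rw [show (edgeOf d).1 = d.edge from rfl, sum_darts_of_edge]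
  norm_num

lemma sum_darts_edgeOf (y : G.edgeSet → ℝ) : ∑ d, y (edgeOf d) = 2 * ∑ e, y e := by
  have h := sum_edges_mul_sum_darts y (fun _ => 1)
  simp only [card_darts_of_edge, mul_one] at h
  rw [← h, ← Finset.sum_mul, mul_comm]

lemma sum_load_mul (μ : V → ℝ) (z : G.Dart → ℝ) :
    ∑ d : G.Dart, μ d.fst * z d = ∑ u, μ u * load G z u := by
  rw [← Finset.sum_fiberwise Finset.univ (fun d : G.Dart => d.fst)]
  refine Finset.sum_congr rfl fun u _ => ?_
  rw [load, Finset.mul_sum]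
  refine Finset.sum_congr rfl fun d hd => ?_
  rw [(Finset.mem_filter.1 hd).2]

lemma load_add (z z' : G.Dart → ℝ) (u : V) : load G (z + z') u = load G z u + load G z' u :=
  Finset.sum_add_distrib

lemma load_smul (t : ℝ) (z : G.Dart → ℝ) (u : V) : load G (t • z) u = t * load G z u := by
  simp [load, Finset.mul_sum]

lemma load_nonneg {z : G.Dart → ℝ} (hz : ∀ d, 0 ≤ z d) (u : V) : 0 ≤ load G z u :=
  Finset.sum_nonneg fun d _ => hz d

variable (G) in
/-- The polytope `C(D)`. -/
def capacityPolytope (D : ℝ) : Set (G.Dart → ℝ) :=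
  {z | (∀ d, z d ∈ Set.Icc (0 : ℝ) 1) ∧ ∀ u, load G z u ≤ D}

variable (G) in
/-- The domain `C(D) × Δ_m` of the saddle point problem. -/
def saddleDomain (D : ℝ) : Set (Point G ℝ) := capacityPolytope G D ×ˢ stdSimplex ℝ G.edgeSet

lemma convex_capacityPolytope (D : ℝ) : Convex ℝ (capacityPolytope G D) := by
  intro z hz z' hz' a b ha hb hab
  refine ⟨fun d => convex_Icc (0 : ℝ) 1 (hz.1 d) (hz'.1 d) ha hb hab, fun u => ?_⟩
  rw [load_add, load_smul, load_smul]
  calc a * load G z u + b * load G z' u ≤ a * D + b * D := by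
        gcongr
        exacts [hz.2 u, hz'.2 u]
    _ = D := by rw [← add_mul, hab, one_mul]

lemma convex_saddleDomain (D : ℝ) : Convex ℝ (saddleDomain G D) :=
  (convex_capacityPolytope D).prod (convex_stdSimplex ℝ _)

/-- The standard inner product on `ℝ^{2m} × ℝ^m`. -/
def pairing (w x : Point G ℝ) : ℝ := ∑ d, w.1 d * x.1 d + ∑ e, w.2 e * x.2 e

lemma pairing_add_left (w w' x : Point G ℝ) :
    pairing (w + w') x = pairing w x + pairing w' x := by
  simp only [pairing, Prod.fst_add, Prod.snd_add, Pi.add_apply, add_mul, Finset.sum_add_distrib]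
  ring

lemma pairing_smul_left (t : ℝ) (w x : Point G ℝ) : pairing (t • w) x = t * pairing w x := by
  simp only [pairing, Prod.smul_fst, Prod.smul_snd, Pi.smul_apply, smul_eq_mul, mul_assoc,
    ← Finset.mul_sum, mul_add]

lemma pairing_add_right (w x x' : Point G ℝ) :
    pairing w (x + x') = pairing w x + pairing w x' := by
  simp only [pairing, Prod.fst_add, Prod.snd_add, Pi.add_apply, mul_add, Finset.sum_add_distrib]
  ring

lemma pairing_smul_right (t : ℝ) (w x : Point G ℝ) : pairing w (t • x) = t * pairing w x := by
  simp only [pairing, Prod.smul_fst, Prod.smul_snd, Pi.smul_apply, smul_eq_mul, mul_left_comm _ t,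
    ← Finset.mul_sum, mul_add]

lemma saddleMap_add (w w' : Point G ℝ) : saddleMap G (w + w') = saddleMap G w + saddleMap G w' := by
  ext i
  · simp [saddleMap]
  · simp [saddleMap, Finset.sum_add_distrib]; ring

lemma pairing_saddleMap (w x : Point G ℝ) :
    pairing w (saddleMap G x) =
      ∑ d, (w.1 d * x.2 (edgeOf d) - w.2 (edgeOf d) * x.1 d) := by
  simp only [pairing, saddleMap, mul_neg, Finset.sum_neg_distrib, sum_edges_mul_sum_darts]
  rw [Finset.sum_sub_distrib, sub_eq_add_neg]
  rfl

/-- The regularizer `φ`.  The sum runs over darts, so that each `y_e log y_e` occurs twice, with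
coefficient `3` instead of `6`. -/
noncomputable def regularizer (w : Point G ℝ) : ℝ :=
  6 * √3 * (∑ d, dartReg (w.1 d) (w.2 (edgeOf d)) - 2)

/-- The objective `⟨w, x⟩ - φ(w)` that the oracle maximizes over the saddle domain. -/
noncomputable def dualObjective (x w : Point G ℝ) : ℝ := pairing w x - regularizer w

/-- Area convexity of the regularizer with respect to the saddle map. -/
lemma area_le_regularizer_gap {D : ℝ} {a b c : Point G ℝ} (ha : a ∈ saddleDomain G D)
    (hb : b ∈ saddleDomain G D) (hc : c ∈ saddleDomain G D) :
    2 * (pairing b (saddleMap G a) + pairing c (saddleMap G b) - pairing c (saddleMap G a)) ≤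
      regularizer a + regularizer b + regularizer c -
        3 * regularizer ((1 / 3 : ℝ) • (a + b + c)) := by
  have h := Finset.sum_le_sum fun (d : G.Dart) (_ : d ∈ Finset.univ) =>
    area_le_dartReg_gap (ha.1.1 d) (hb.1.1 d) (hc.1.1 d) (ha.2.1 (edgeOf d)) (hb.2.1 (edgeOf d))
      (hc.2.1 (edgeOf d))
  simp only [← Finset.mul_sum, Finset.sum_add_distrib, Finset.sum_sub_distrib] at h
  simp only [pairing_saddleMap, regularizer, Finset.sum_sub_distrib, Prod.smul_fst, Prod.smul_snd,
    Prod.fst_add, Prod.snd_add, Pi.smul_apply, Pi.add_apply, smul_eq_mul, one_div_mul_eq_div]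
  linarith

/-- One step of the dual extrapolation scheme: an approximate maximization at `x`, followed by one
at the extrapolated point, increases the potential `max_c (⟨c, x⟩ - φ(c))` by at most `δ`. -/
lemma dualObjective_update_le {D δ M : ℝ} {x a b c : Point G ℝ}
    (hM : ∀ p ∈ saddleDomain G D, dualObjective x p ≤ M)
    (ha : a ∈ saddleDomain G D)
    (ha' : ∀ p ∈ saddleDomain G D, dualObjective x p ≤ dualObjective x a + δ)
    (hb : b ∈ saddleDomain G D)
    (hb' : ∀ p ∈ saddleDomain G D, dualObjective (x + (2 : ℝ) • saddleMap G a) p ≤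
      dualObjective (x + (2 : ℝ) • saddleMap G a) b + δ)
    (hc : c ∈ saddleDomain G D) : dualObjective (x + saddleMap G b) c ≤ M + δ := by
  have hm : (1 / 3 : ℝ) • (a + b + c) ∈ saddleDomain G D := by
    have h₁ := convex_saddleDomain D ha hb (show (0 : ℝ) ≤ 1 / 2 by norm_num)
      (show (0 : ℝ) ≤ 1 / 2 by norm_num) (by norm_num)
    have h₂ := convex_saddleDomain D h₁ hc (show (0 : ℝ) ≤ 2 / 3 by norm_num)
      (show (0 : ℝ) ≤ 1 / 3 by norm_num) (by norm_num)
    convert h₂ using 1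
    module
  have harea := area_le_regularizer_gap ha hb hc
  have h₁ := hM _ hm
  have h₂ := ha' _ hm
  have h₃ := hb' _ hc
  simp only [dualObjective, pairing_add_right, pairing_smul_right, pairing_smul_left,
    pairing_add_left] at h₁ h₂ h₃ ⊢
  linarith

end Domain

section Oracle

variable {V : Type*} [Fintype V] [DecidableEq V] {G : SimpleGraph V} [DecidableRel G.Adj]

/-! ### The exact minimization in `z` -/

lemma regScale_pos : (0 : ℝ) < regScale := by
  show (0 : ℝ) < 6 * √3
  positivity

/-- `t ↦ max 0 (min 1 ((p - t) / (2 y)))` is affine between consecutive breakpoints. -/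
lemma clamp_interpolate {y p a b t : ℝ} (hy : 0 < y) (hab : a ≤ b) (ht : t ∈ Set.Icc (0 : ℝ) 1)
    (h₁ : p ≤ a ∨ b ≤ p) (h₂ : p - 2 * y ≤ a ∨ b ≤ p - 2 * y) :
    max 0 (min 1 ((p - (a + t * (b - a))) / (2 * y))) =
      max 0 (min 1 ((p - a) / (2 * y))) +
        t * (max 0 (min 1 ((p - b) / (2 * y))) - max 0 (min 1 ((p - a) / (2 * y)))) := by
  have hy2 : 0 < 2 * y := by linarith
  have hlow : ∀ s, p ≤ s → max 0 (min 1 ((p - s) / (2 * y))) = 0 := fun s hs =>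
    max_eq_left ((min_le_right _ _).trans (div_nonpos_of_nonpos_of_nonneg (by linarith) hy2.le))
  have hhigh : ∀ s, s ≤ p - 2 * y → max 0 (min 1 ((p - s) / (2 * y))) = 1 := fun s hs => by
    rw [min_eq_left ((one_le_div hy2).2 (by linarith)), max_eq_right zero_le_one]
  have hmid : ∀ s, s ≤ p → p - 2 * y ≤ s →
      max 0 (min 1 ((p - s) / (2 * y))) = (p - s) / (2 * y) := fun s hs hs' => by
    rw [min_eq_right ((div_le_one hy2).2 (by linarith)),
      max_eq_right (div_nonneg (by linarith) hy2.le)]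
  have ha : a ≤ a + t * (b - a) := by nlinarith [ht.1]
  have hb : a + t * (b - a) ≤ b := by nlinarith [ht.2]
  rcases h₁ with h₁ | h₁
  · rw [hlow _ (h₁.trans ha), hlow _ h₁, hlow _ (h₁.trans hab)]
    ring
  rcases h₂ with h₂ | h₂
  · rw [hmid _ (hb.trans h₁) (h₂.trans ha), hmid _ (hab.trans h₁) h₂, hmid _ h₁ (h₂.trans hab)]
    ring
  · rw [hhigh _ (hb.trans h₂), hhigh _ (hab.trans h₂), hhigh _ h₂]
    ring

lemma clampedResponse_mem_Icc (y : G.edgeSet → ℝ) (s : G.Dart → ℝ) (lam : ℝ) (d : G.Dart) :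
    clampedResponse G y s lam d ∈ Set.Icc (0 : ℝ) 1 :=
  ⟨le_max_left _ _, max_le zero_le_one (min_le_left _ _)⟩

/-- The computed multiplier is nonnegative, makes the response feasible, and satisfies
complementary slackness. -/
lemma multiplier_spec {D : ℝ} (hD : 0 < D) {y : G.edgeSet → ℝ} (hy : ∀ e, 0 < y e)
    (s : G.Dart → ℝ) (u : V) :
    0 ≤ multiplier G D y s u ∧
      load G (clampedResponse G y s (multiplier G D y s u)) u ≤ D ∧
      (multiplier G D y s u = 0 ∨
        load G (clampedResponse G y s (multiplier G D y s u)) u = D) := by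
  set f : ℝ → ℝ := fun lam => load G (clampedResponse G y s lam) u with hf
  set P : Finset ℝ := breakpoints G y s u with hP
  by_cases h0 : f 0 ≤ D
  · have hm : multiplier G D y s u = 0 := if_pos h0
    rw [hm]
    exact ⟨le_rfl, h0, Or.inl rfl⟩
  set a : ℝ := (P.filter fun p => D ≤ f p).fold max 0 id with ha
  set b : ℝ := (P.filter fun p => a < p).fold min (P.fold max 0 id) id with hb
  have hm : multiplier G D y s u = a + (f a - D) * (b - a) / (f a - f b) := if_neg h0
  rw [hm]
  have ha0 : 0 ≤ a := (Finset.le_fold_max 0).2 (Or.inl le_rfl)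
  have hfa : D ≤ f a := by
    rcases (Finset.le_fold_max a).1 ha.le with h | ⟨p, hp, h⟩
    · rw [le_antisymm h ha0]
      exact (not_le.1 h0).le
    · have : p ≤ a := (Finset.le_fold_max p).2 (Or.inr ⟨p, hp, le_rfl⟩)
      rw [le_antisymm h this]
      exact (Finset.mem_filter.1 hp).2
  -- Beyond the last breakpoint every response vanishes.
  set top : ℝ := P.fold max 0 id with htop
  have htopP : top ∈ P := by
    rcases (Finset.le_fold_max top).1 htop.le with h | ⟨p, hp, h⟩
    · rw [le_antisymm h ((Finset.le_fold_max 0).2 (Or.inl le_rfl))]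
      exact Finset.mem_insert_self _ _
    · have : p ≤ top := (Finset.le_fold_max p).2 (Or.inr ⟨p, hp, le_rfl⟩)
      rwa [le_antisymm h this]
  have mem_P : ∀ d : G.Dart, d.fst = u → ∀ p : ℝ,
      p = s d / regScale ∨ p = s d / regScale - 2 * y (edgeOf d) → 0 < p → p ∈ P := by
    intro d hd p hp hp0
    refine Finset.mem_insert_of_mem (Finset.mem_filter.2 ⟨Finset.mem_union.2 ?_, hp0⟩)
    rcases hp with rfl | rfl
    · exact Or.inl (Finset.mem_image.2 ⟨d, by simpa using hd, rfl⟩)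
    · exact Or.inr (Finset.mem_image.2 ⟨d, by simpa using hd, rfl⟩)
  have hftop : f top = 0 := by
    refine Finset.sum_eq_zero fun d hd => ?_
    have hdu := (Finset.mem_filter.1 hd).2
    have : s d / regScale ≤ top := by
      rcases le_or_gt (s d / regScale) 0 with h | h
      · exact h.trans ((Finset.le_fold_max 0).2 (Or.inl le_rfl))
      · exact (Finset.le_fold_max _).2 (Or.inr ⟨_, mem_P d hdu _ (Or.inl rfl) h, le_rfl⟩)
    exact max_eq_left ((min_le_right _ _).trans (div_nonpos_of_nonpos_of_nonneg (by linarith)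
      (by linarith [hy ⟨d.edge, d.edge_mem⟩])))
  have hatop : a < top := by
    refine lt_of_le_of_ne ((Finset.fold_max_le _).2 ⟨(Finset.le_fold_max 0).2 (Or.inl le_rfl),
      fun p hp => (Finset.le_fold_max p).2 (Or.inr ⟨p, (Finset.mem_filter.1 hp).1, le_rfl⟩)⟩)
      fun h => ?_
    rw [h, hftop] at hfa
    linarith
  have hbP : b ∈ P ∧ a < b := by
    rcases (Finset.fold_min_le b).1 hb.ge with h | ⟨p, hp, h⟩
    · have : b ≤ top := (Finset.fold_min_le _).2 (Or.inl le_rfl)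
      rw [le_antisymm this h]
      exact ⟨htopP, hatop⟩
    · have : b ≤ p := (Finset.fold_min_le _).2 (Or.inr ⟨p, hp, le_rfl⟩)
      rw [le_antisymm this h]
      exact Finset.mem_filter.1 hp
  have hfb : f b < D := by
    by_contra h
    have : b ≤ a := (Finset.le_fold_max b).2
      (Or.inr ⟨b, Finset.mem_filter.2 ⟨hbP.1, not_lt.1 h⟩, le_rfl⟩)
    linarith [hbP.2]
  have consecutive : ∀ p : ℝ, (0 < p → p ∈ P) → p ≤ a ∨ b ≤ p := by
    intro p hp
    rcases le_or_gt p a with h | h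
    · exact Or.inl h
    · exact Or.inr ((Finset.fold_min_le _).2
        (Or.inr ⟨p, Finset.mem_filter.2 ⟨hp (ha0.trans_lt h), h⟩, le_rfl⟩))
  set t : ℝ := (f a - D) / (f a - f b) with ht
  have hden : 0 < f a - f b := by linarith
  have ht01 : t ∈ Set.Icc (0 : ℝ) 1 :=
    ⟨div_nonneg (by linarith) hden.le, (div_le_one hden).2 (by linarith)⟩
  have hlam : a + (f a - D) * (b - a) / (f a - f b) = a + t * (b - a) := by
    rw [ht, div_mul_eq_mul_div]
  have hload : f (a + t * (b - a)) = D := by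
    have h₁ : f (a + t * (b - a)) = f a + t * (f b - f a) := by
      simp only [hf, load, ← Finset.sum_sub_distrib, Finset.mul_sum, ← Finset.sum_add_distrib]
      refine Finset.sum_congr rfl fun d hd => ?_
      have hdu := (Finset.mem_filter.1 hd).2
      exact clamp_interpolate (hy _) hbP.2.le ht01
        (consecutive _ (mem_P d hdu _ (Or.inl rfl))) (consecutive _ (mem_P d hdu _ (Or.inr rfl)))
    have h₂ : t * (f a - f b) = f a - D := div_mul_cancel₀ _ hden.ne'
    linarith
  rw [hlam]
  refine ⟨?_, hload.le, Or.inr hload⟩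
  nlinarith [ht01.1, hbP.2]

lemma zStep_load (D : ℝ) (y : G.edgeSet → ℝ) (s : G.Dart → ℝ) (u : V) :
    load G (zStep G D y s) u = load G (clampedResponse G y s (multiplier G D y s u)) u := by
  refine Finset.sum_congr rfl fun d hd => ?_
  rw [zStep, (Finset.mem_filter.1 hd).2]

lemma zStep_mem {D : ℝ} (hD : 0 < D) {y : G.edgeSet → ℝ} (hy : ∀ e, 0 < y e)
    (s : G.Dart → ℝ) : zStep G D y s ∈ capacityPolytope G D :=
  ⟨fun d => clampedResponse_mem_Icc _ _ _ _, fun u => by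
    rw [zStep_load]
    exact (multiplier_spec hD hy s u).2.1⟩

lemma clamp_minimizes {y p z : ℝ} (hy : 0 < y) (hz : z ∈ Set.Icc (0 : ℝ) 1) :
    y * (max 0 (min 1 (p / (2 * y)))) ^ 2 - p * max 0 (min 1 (p / (2 * y))) ≤ y * z ^ 2 - p * z := by
  obtain ⟨q, rfl⟩ : ∃ q, p = 2 * y * q := ⟨p / (2 * y), (mul_div_cancel₀ _ (by positivity)).symm⟩
  rw [mul_div_cancel_left₀ q (by positivity)]
  have h : (max 0 (min 1 q) - q) ^ 2 ≤ (z - q) ^ 2 := by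
    obtain ⟨hz0, hz1⟩ := hz
    rcases le_total q 0 with h | h
    · rw [max_eq_left ((min_le_right _ _).trans h)]
      nlinarith
    · rcases le_total q 1 with h' | h'
      · rw [min_eq_right h', max_eq_right h]
        nlinarith [sq_nonneg (z - q)]
      · rw [min_eq_left h', max_eq_right zero_le_one]
        nlinarith
  nlinarith [mul_le_mul_of_nonneg_left h hy.le]

/-- By Lagrangian duality, `zStep` minimizes `z ↦ φ(z, y) - ⟨z, s⟩` over `C(D)`. -/
lemma zStep_minimizes {D : ℝ} (hD : 0 < D) {y : G.edgeSet → ℝ} (hy : ∀ e, 0 < y e)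
    (s : G.Dart → ℝ) {z : G.Dart → ℝ} (hz : z ∈ capacityPolytope G D) :
    ∑ d, (regScale * (y (edgeOf d) * zStep G D y s d ^ 2) - s d * zStep G D y s d) ≤
      ∑ d, (regScale * (y (edgeOf d) * z d ^ 2) - s d * z d) := by
  set z' := zStep G D y s with hz'
  set μ := multiplier G D y s with hμ
  have hσ : (0 : ℝ) < regScale := regScale_pos
  have h₁ : ∑ d, (y (edgeOf d) * z' d ^ 2 - (s d / regScale - μ d.fst) * z' d) ≤
      ∑ d, (y (edgeOf d) * z d ^ 2 - (s d / regScale - μ d.fst) * z d) :=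
    Finset.sum_le_sum fun d _ => clamp_minimizes (hy _) (hz.1 d)
  have h₂ : ∑ d, μ d.fst * z d ≤ ∑ d, μ d.fst * z' d := by
    rw [sum_load_mul, sum_load_mul]
    refine Finset.sum_le_sum fun u _ => ?_
    obtain ⟨hμ0, -, hslack⟩ := multiplier_spec hD hy s u
    rw [← zStep_load] at hslack
    rcases hslack with h | h
    · rw [hμ, h, zero_mul, zero_mul]
    · rw [hz', h]
      exact mul_le_mul_of_nonneg_left (hz.2 u) hμ0
  have e : ∀ x : G.Dart → ℝ, ∑ d, (regScale * (y (edgeOf d) * x d ^ 2) - s d * x d) =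
      regScale * (∑ d, (y (edgeOf d) * x d ^ 2 - (s d / regScale - μ d.fst) * x d) -
        ∑ d, μ d.fst * x d) := by
    intro x
    rw [← Finset.sum_sub_distrib, Finset.mul_sum]
    refine Finset.sum_congr rfl fun d _ => ?_
    field_simp
    ring
  rw [e, e]
  gcongr

end Oracle

section Oracle

variable {V : Type*} [Fintype V] [DecidableEq V] {G : SimpleGraph V} [DecidableRel G.Adj]

/-! ### Alternating minimization -/

lemma yStep_pos [Nonempty G.edgeSet] (r : G.edgeSet → ℝ) (z : G.Dart → ℝ) (e : G.edgeSet) :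
    0 < yStep G r z e :=
  div_pos (Real.exp_pos _) (Finset.sum_pos (fun _ _ => Real.exp_pos _) Finset.univ_nonempty)

lemma yStep_mem [Nonempty G.edgeSet] (r : G.edgeSet → ℝ) (z : G.Dart → ℝ) :
    yStep G r z ∈ stdSimplex ℝ G.edgeSet := by
  refine ⟨fun e => (yStep_pos r z e).le, ?_⟩
  simp only [yStep, ← Finset.sum_div]
  exact div_self (Finset.sum_pos (fun _ _ => Real.exp_pos _) Finset.univ_nonempty).ne'

/-- Stationarity of the Gibbs weights: the partial derivative in `y` is the same for all edges. -/
lemma exists_yStep_stationary [Nonempty G.edgeSet] (r : G.edgeSet → ℝ) (z : G.Dart → ℝ) :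
    ∃ κ : ℝ, ∀ e, regScale *
      ∑ d : G.Dart with d.edge = e.1, (z d ^ 2 + 3 * Real.log (yStep G r z e) + 3) - r e = κ := by
  have hpos : 0 < ∑ e', Real.exp (-((∑ d : G.Dart with d.edge = e'.1, z d ^ 2) -
      r e' / regScale) / 6) := Finset.sum_pos (fun _ _ => Real.exp_pos _) Finset.univ_nonempty
  refine ⟨regScale * (6 - 6 * Real.log (∑ e', Real.exp (-((∑ d : G.Dart with d.edge = e'.1,
    z d ^ 2) - r e' / regScale) / 6))), fun e => ?_⟩
  have hlog : Real.log (yStep G r z e) =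
      -((∑ d : G.Dart with d.edge = e.1, z d ^ 2) - r e / regScale) / 6 -
        Real.log (∑ e', Real.exp (-((∑ d : G.Dart with d.edge = e'.1, z d ^ 2) -
          r e' / regScale) / 6)) := by
    conv_rhs => rw [← Real.log_exp (-((∑ d : G.Dart with d.edge = e.1, z d ^ 2) -
      r e / regScale) / 6)]
    rw [← Real.log_div (Real.exp_pos _).ne' hpos.ne']
    rfl
  have hσ : (regScale : ℝ) * (r e / regScale) = r e := mul_div_cancel₀ _ regScale_pos.ne'
  have hsum : ∑ d : G.Dart with d.edge = e.1, (z d ^ 2 + 3 * Real.log (yStep G r z e) + 3) =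
      (∑ d : G.Dart with d.edge = e.1, z d ^ 2) + 6 * Real.log (yStep G r z e) + 6 := by
    have h2 := card_darts_of_edge e
    rw [Finset.sum_add_distrib, Finset.sum_add_distrib]
    have hc : ∀ c : ℝ, ∑ d : G.Dart with d.edge = e.1, c = 2 * c := fun c => by
      rw [← h2, Finset.sum_mul, one_mul]
    rw [hc, hc]
    ring
  rw [hsum, hlog]
  linear_combination hσ

/-- The exact expansion of the objective around a point whose `y`-part is the Gibbs minimizer: the
linear term in `y` vanishes, and the remainder is a sum of Bregman divergences. -/
lemma dualObjective_eq_of_yStep [Nonempty G.edgeSet] (x : Point G ℝ) (z : G.Dart → ℝ)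
    {u : Point G ℝ} (hu : u.2 ∈ stdSimplex ℝ G.edgeSet) :
    dualObjective x u = dualObjective x (z, yStep G x.2 z) -
      ∑ d, (2 * regScale * yStep G x.2 z (edgeOf d) * z d - x.1 d) * (u.1 d - z d) -
      regScale * ∑ d, yStep G x.2 z (edgeOf d) *
        bregmanProfile (u.2 (edgeOf d) / yStep G x.2 z (edgeOf d)) (z d) (u.1 d - z d) := by
  set y := yStep G x.2 z with hy
  have hypos : ∀ e, 0 < y e := yStep_pos x.2 z
  obtain ⟨κ, hκ⟩ := exists_yStep_stationary x.2 z
  have hgrad : regScale * ∑ d, (u.2 (edgeOf d) - y (edgeOf d)) *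
      (z d ^ 2 + 3 * Real.log (y (edgeOf d)) + 3) = ∑ e, (u.2 e - y e) * x.2 e := by
    have h₁ : ∑ d, (u.2 (edgeOf d) - y (edgeOf d)) *
        (z d ^ 2 + 3 * Real.log (y (edgeOf d)) + 3) =
        ∑ e, (u.2 e - y e) * ∑ d : G.Dart with d.edge = e.1, (z d ^ 2 + 3 * Real.log (y e) + 3) := by
      rw [← sum_edges_sum_darts]
      refine Finset.sum_congr rfl fun e _ => ?_
      rw [Finset.mul_sum]
      refine Finset.sum_congr rfl fun d hd => ?_
      rw [show edgeOf d = e from Subtype.ext (Finset.mem_filter.1 hd).2]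
    have h₂ : ∑ e, (u.2 e - y e) * κ = 0 := by
      rw [← Finset.sum_mul, Finset.sum_sub_distrib, hu.2, (yStep_mem x.2 z).2, sub_self, zero_mul]
    rw [h₁, ← sub_eq_zero, ← h₂, Finset.mul_sum, ← Finset.sum_sub_distrib]
    refine Finset.sum_congr rfl fun e _ => ?_
    rw [← hκ e]
    ring
  have hreg : ∑ d, dartReg (u.1 d) (u.2 (edgeOf d)) = ∑ d, dartReg (z d) (y (edgeOf d)) +
      ∑ d, 2 * y (edgeOf d) * z d * (u.1 d - z d) +
      ∑ d, (u.2 (edgeOf d) - y (edgeOf d)) * (z d ^ 2 + 3 * Real.log (y (edgeOf d)) + 3) +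
      ∑ d, y (edgeOf d) * bregmanProfile (u.2 (edgeOf d) / y (edgeOf d)) (z d) (u.1 d - z d) := by
    rw [← Finset.sum_add_distrib, ← Finset.sum_add_distrib, ← Finset.sum_add_distrib]
    refine Finset.sum_congr rfl fun d _ => ?_
    rw [dartReg_eq_linearization_add (z := z d) (hypos (edgeOf d)) (hu.1 (edgeOf d))]
    ring
  have hlin : ∑ d, (2 * regScale * y (edgeOf d) * z d - x.1 d) * (u.1 d - z d) =
      regScale * ∑ d, 2 * y (edgeOf d) * z d * (u.1 d - z d) -
        (∑ d, u.1 d * x.1 d - ∑ d, z d * x.1 d) := by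
    rw [← Finset.sum_sub_distrib, Finset.mul_sum, ← Finset.sum_sub_distrib]
    exact Finset.sum_congr rfl fun d _ => by ring
  have hr : ∑ e, (u.2 e - y e) * x.2 e = ∑ e, u.2 e * x.2 e - ∑ e, y e * x.2 e := by
    rw [← Finset.sum_sub_distrib]
    exact Finset.sum_congr rfl fun e _ => by ring
  rw [hr] at hgrad
  have hσ : (regScale : ℝ) = 6 * √3 := rfl
  rw [hlin]
  simp only [dualObjective, regularizer, pairing, ← hσ]
  rw [hreg]
  linear_combination -hgrad

lemma dualObjective_le_yStep [Nonempty G.edgeSet] (x : Point G ℝ) {u : Point G ℝ}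
    (hu : u.2 ∈ stdSimplex ℝ G.edgeSet) :
    dualObjective x u ≤ dualObjective x (u.1, yStep G x.2 u.1) := by
  rw [dualObjective_eq_of_yStep x u.1 hu]
  have h : 0 ≤ regScale * ∑ d, yStep G x.2 u.1 (edgeOf d) *
      bregmanProfile (u.2 (edgeOf d) / yStep G x.2 u.1 (edgeOf d)) (u.1 d) (u.1 d - u.1 d) := by
    refine mul_nonneg regScale_pos.le (Finset.sum_nonneg fun d _ => ?_)
    refine mul_nonneg (yStep_pos _ _ _).le ?_
    have := InformationTheory.klFun_nonneg
      (div_nonneg (hu.1 (edgeOf d)) (yStep_pos x.2 u.1 (edgeOf d)).le)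
    simp only [bregmanProfile, sub_self]
    linarith
  simp only [sub_self, mul_zero, Finset.sum_const_zero, sub_zero] at h ⊢
  linarith

/-- One exact minimization in `z`, after one in `y`, reduces the gap to every competitor by the
factor `2/3`.  The competitor for the step is `z + (u.1 - z) / 3`. -/
lemma dualObjective_gap_zStep_le [Nonempty G.edgeSet] {D : ℝ} (hD : 0 < D) (x : Point G ℝ)
    {z : G.Dart → ℝ} (hz : z ∈ capacityPolytope G D) {u : Point G ℝ} (hu : u ∈ saddleDomain G D) :
    dualObjective x u -
        dualObjective x (zStep G D (yStep G x.2 z) x.1, yStep G x.2 z) ≤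
      2 / 3 * (dualObjective x u - dualObjective x (z, yStep G x.2 z)) := by
  have hexp := dualObjective_eq_of_yStep x z hu.2
  set y := yStep G x.2 z with hy
  have hypos : ∀ e, 0 < y e := yStep_pos x.2 z
  have hσ : (0 : ℝ) < regScale := regScale_pos
  have hmid : (2 / 3 : ℝ) • z + (1 / 3 : ℝ) • u.1 ∈ capacityPolytope G D :=
    convex_capacityPolytope D hz hu.1 (by norm_num) (by norm_num) (by norm_num)
  have hmin := zStep_minimizes hD hypos x.1 hmid
  set z' := zStep G D y x.1 with hz'
  have hdiff : dualObjective x (z', y) = dualObjective x (z, y) +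
      ∑ d, (regScale * (y (edgeOf d) * z d ^ 2) - x.1 d * z d) -
      ∑ d, (regScale * (y (edgeOf d) * z' d ^ 2) - x.1 d * z' d) := by
    have hσ' : (regScale : ℝ) = 6 * √3 := rfl
    simp only [dualObjective, regularizer, pairing, dartReg, Finset.sum_add_distrib,
      Finset.sum_sub_distrib, ← Finset.mul_sum, ← hσ', mul_comm (x.1 _)]
    ring
  have hquad : ∑ d, (regScale * (y (edgeOf d) * ((2 / 3 : ℝ) • z + (1 / 3 : ℝ) • u.1) d ^ 2) -
        x.1 d * ((2 / 3 : ℝ) • z + (1 / 3 : ℝ) • u.1) d) =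
      ∑ d, (regScale * (y (edgeOf d) * z d ^ 2) - x.1 d * z d) +
      1 / 3 * ∑ d, (2 * regScale * y (edgeOf d) * z d - x.1 d) * (u.1 d - z d) +
      1 / 3 * (regScale * ∑ d, y (edgeOf d) * (1 / 3 * (u.1 d - z d) ^ 2)) := by
    rw [Finset.mul_sum, Finset.mul_sum, Finset.mul_sum, ← Finset.sum_add_distrib,
      ← Finset.sum_add_distrib]
    refine Finset.sum_congr rfl fun d _ => ?_
    simp only [Pi.add_apply, Pi.smul_apply, smul_eq_mul]
    ring
  have hbreg : regScale * ∑ d, y (edgeOf d) * (1 / 3 * (u.1 d - z d) ^ 2) ≤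
      regScale * ∑ d, y (edgeOf d) *
        bregmanProfile (u.2 (edgeOf d) / y (edgeOf d)) (z d) (u.1 d - z d) := by
    refine mul_le_mul_of_nonneg_left (Finset.sum_le_sum fun d _ => ?_) hσ.le
    refine mul_le_mul_of_nonneg_left ?_ (hypos _).le
    exact third_sq_le_bregmanProfile (div_nonneg (hu.2.1 _) (hypos _).le) (hz.1 d)
      (by simpa using hu.1.1 d)
  linarith

lemma alternatingStep_iterate_mem [Nonempty G.edgeSet] {D : ℝ} (hD : 0 < D) (x : Point G ℝ)
    (k : ℕ) : (alternatingStep G D x)^[k + 1] (0, 0) ∈ saddleDomain G D := by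
  rw [Function.iterate_succ_apply']
  exact ⟨zStep_mem hD (yStep_pos _ _) _, yStep_mem _ _⟩

lemma alternatingStep_iterate_fst_mem [Nonempty G.edgeSet] {D : ℝ} (hD : 0 < D) (x : Point G ℝ)
    (k : ℕ) : ((alternatingStep G D x)^[k] (0, 0)).1 ∈ capacityPolytope G D := by
  cases k with
  | zero => exact ⟨fun d => by simp, fun u => by simpa [load] using hD.le⟩
  | succ k => exact (alternatingStep_iterate_mem hD x k).1

lemma oracle_mem [Nonempty G.edgeSet] {D : ℝ} (hD : 0 < D) (K : ℕ) (x : Point G ℝ) :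
    oracle G D K x ∈ saddleDomain G D :=
  alternatingStep_iterate_mem hD x K

/-- Linear convergence of alternating minimization, in terms of a bound `B` for the variation of the
objective on the domain. -/
lemma dualObjective_le_oracle_add [Nonempty G.edgeSet] {D B : ℝ} (hD : 0 < D) (K : ℕ)
    (x : Point G ℝ) (hB : ∀ u ∈ saddleDomain G D, ∀ p ∈ saddleDomain G D,
      dualObjective x u - dualObjective x p ≤ B) {u : Point G ℝ} (hu : u ∈ saddleDomain G D) :
    dualObjective x u ≤ dualObjective x (oracle G D K x) + (2 / 3) ^ (K + 1) * B := by
  have key : ∀ k, dualObjective x u - dualObjective x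
      (((alternatingStep G D x)^[k] (0, 0)).1,
        yStep G x.2 ((alternatingStep G D x)^[k] (0, 0)).1) ≤ (2 / 3) ^ k * B := by
    intro k
    induction k with
    | zero =>
      rw [pow_zero, one_mul]
      exact hB u hu _ ⟨alternatingStep_iterate_fst_mem hD x 0, yStep_mem _ _⟩
    | succ k ih =>
      have h₁ := dualObjective_gap_zStep_le hD x (alternatingStep_iterate_fst_mem hD x k) hu
      have h₂ := dualObjective_le_yStep x (alternatingStep_iterate_mem hD x k).2
      rw [Function.iterate_succ_apply'] at h₂ ⊢
      simp only [alternatingStep] at h₂ h₁ ih ⊢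
      rw [pow_succ]
      linarith
  have h := dualObjective_gap_zStep_le hD x (alternatingStep_iterate_fst_mem hD x K) hu
  have hK := key K
  rw [oracle, Function.iterate_succ_apply', pow_succ]
  simp only [alternatingStep] at h hK ⊢
  linarith

end Oracle

section Solver

variable {V : Type*} [Fintype V] [DecidableEq V] {G : SimpleGraph V} [DecidableRel G.Adj]

/-! ### The saddle point solver -/

variable (G) in
/-- The width `6√3 (2 + 6 log m)` of the range of the regularizer on the saddle domain. -/
noncomputable def regularizerRange : ℝ := 6 * √3 * (2 + 6 * Real.log G.edgeFinset.card)

lemma card_edgeSet_eq : (Fintype.card G.edgeSet : ℝ) = (G.edgeFinset.card : ℝ) := by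
  rw [SimpleGraph.edgeFinset_card]

lemma regularizer_nonpos {D : ℝ} {w : Point G ℝ} (hw : w ∈ saddleDomain G D) :
    regularizer w ≤ 0 := by
  have h : ∑ d, dartReg (w.1 d) (w.2 (edgeOf d)) ≤ ∑ d, w.2 (edgeOf d) := by
    refine Finset.sum_le_sum fun d _ => ?_
    have hy0 := hw.2.1 (edgeOf d)
    have hy1 : w.2 (edgeOf d) ≤ 1 := by
      rw [← hw.2.2]
      exact Finset.single_le_sum (fun e _ => hw.2.1 e) (Finset.mem_univ _)
    obtain ⟨hz0, hz1⟩ := hw.1.1 d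
    have h₁ := Real.mul_log_nonpos hy0 hy1
    have h₂ : w.2 (edgeOf d) * w.1 d ^ 2 ≤ w.2 (edgeOf d) * 1 :=
      mul_le_mul_of_nonneg_left (pow_le_one₀ hz0 hz1) hy0
    unfold dartReg
    linarith
  rw [sum_darts_edgeOf, hw.2.2] at h
  exact mul_nonpos_of_nonneg_of_nonpos (by positivity) (by linarith)

/-- The entropy of a distribution on the edges is at most `log m`. -/
lemma neg_log_card_le_sum_mul_log [Nonempty G.edgeSet] {y : G.edgeSet → ℝ}
    (hy : y ∈ stdSimplex ℝ G.edgeSet) :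
    -Real.log G.edgeFinset.card ≤ ∑ e, y e * Real.log (y e) := by
  have hm : (0 : ℝ) < G.edgeFinset.card := by
    rw [← card_edgeSet_eq]
    exact Nat.cast_pos.2 Fintype.card_pos
  set m : ℝ := (G.edgeFinset.card : ℝ) with hmdef
  have h : ∀ e, 0 ≤ m * (y e * Real.log (y e)) + m * Real.log m * y e + 1 - m * y e := fun e => by
    have h := InformationTheory.klFun_nonneg (mul_nonneg hm.le (hy.1 e))
    rw [InformationTheory.klFun_apply] at h
    rcases (hy.1 e).eq_or_lt with h0 | h0
    · rw [← h0]; simp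
    · rw [Real.log_mul hm.ne' h0.ne'] at h
      linarith
  have hsum := Finset.sum_nonneg fun e (_ : e ∈ Finset.univ) => h e
  rw [Finset.sum_sub_distrib, Finset.sum_add_distrib, Finset.sum_add_distrib, ← Finset.mul_sum,
    ← Finset.mul_sum, ← Finset.mul_sum, hy.2, Finset.sum_const, Finset.card_univ, nsmul_eq_mul,
    card_edgeSet_eq, ← hmdef] at hsum
  have : 0 ≤ m * (∑ e, y e * Real.log (y e) + Real.log m) := by linarith
  linarith [nonneg_of_mul_nonneg_right this hm]

lemma neg_range_le_regularizer [Nonempty G.edgeSet] {D : ℝ} {w : Point G ℝ}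
    (hw : w ∈ saddleDomain G D) : -regularizerRange G ≤ regularizer w := by
  have h : ∑ d, 3 * (w.2 (edgeOf d) * Real.log (w.2 (edgeOf d))) ≤
      ∑ d, dartReg (w.1 d) (w.2 (edgeOf d)) :=
    Finset.sum_le_sum fun d _ => le_add_of_nonneg_left
      (mul_nonneg (hw.2.1 (edgeOf d)) (sq_nonneg (w.1 d)))
  rw [← Finset.mul_sum, sum_darts_edgeOf fun e => w.2 e * Real.log (w.2 e)] at h
  have h₂ := neg_log_card_le_sum_mul_log hw.2
  rw [regularizerRange, regularizer, ← mul_neg]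
  refine mul_le_mul_of_nonneg_left ?_ (by positivity)
  linarith

variable (G) in
/-- The bounds satisfied by a sum of `τ` points of the saddle domain. -/
def mulSaddleBox (τ : ℝ) : Set (Point G ℝ) :=
  {w | (∀ d, w.1 d ∈ Set.Icc 0 τ) ∧ (∀ e, 0 ≤ w.2 e) ∧ ∑ e, w.2 e = τ}

lemma mulSaddleBox_add {τ τ' : ℝ} {w w' : Point G ℝ} (hw : w ∈ mulSaddleBox G τ)
    (hw' : w' ∈ mulSaddleBox G τ') : w + w' ∈ mulSaddleBox G (τ + τ') :=
  ⟨fun d => ⟨add_nonneg (hw.1 d).1 (hw'.1 d).1, add_le_add (hw.1 d).2 (hw'.1 d).2⟩,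
    fun e => add_nonneg (hw.2.1 e) (hw'.2.1 e), by
      simp [Finset.sum_add_distrib, hw.2.2, hw'.2.2]⟩

lemma saddleDomain_subset_mulSaddleBox (D : ℝ) : saddleDomain G D ⊆ mulSaddleBox G 1 :=
  fun _ hw => ⟨hw.1.1, hw.2.1, hw.2.2⟩

lemma abs_pairing_saddleMap_le {D τ : ℝ} {p w : Point G ℝ} (hp : p ∈ saddleDomain G D)
    (hw : w ∈ mulSaddleBox G τ) : |pairing p (saddleMap G w)| ≤ 2 * τ := by
  have h₁ : ∑ d, w.2 (edgeOf d) = 2 * τ := by rw [sum_darts_edgeOf, hw.2.2]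
  have h₂ : ∑ d, p.2 (edgeOf d) * τ = 2 * τ := by
    rw [← Finset.sum_mul, sum_darts_edgeOf, hp.2.2, mul_one]
  rw [pairing_saddleMap, abs_le]
  constructor
  · rw [← h₂, ← Finset.sum_neg_distrib]
    refine Finset.sum_le_sum fun d _ => ?_
    have := mul_le_mul_of_nonneg_left (hw.1 d).2 (hp.2.1 (edgeOf d))
    linarith [mul_nonneg (hp.1.1 d).1 (hw.2.1 (edgeOf d))]
  · rw [← h₁]
    refine Finset.sum_le_sum fun d _ => ?_
    have := mul_le_of_le_one_left (hw.2.1 (edgeOf d)) (hp.1.1 d).2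
    linarith [mul_nonneg (hp.2.1 (edgeOf d)) (hw.1 d).1]

lemma dualObjective_saddleMap_sub_le [Nonempty G.edgeSet] {D τ : ℝ} {u p w : Point G ℝ}
    (hu : u ∈ saddleDomain G D) (hp : p ∈ saddleDomain G D) (hw : w ∈ mulSaddleBox G τ) :
    dualObjective (saddleMap G w) u - dualObjective (saddleMap G w) p ≤
      4 * τ + regularizerRange G := by
  have h₁ := (abs_le.1 (abs_pairing_saddleMap_le hu hw)).2
  have h₂ := (abs_le.1 (abs_pairing_saddleMap_le hp hw)).1
  have h₃ := neg_range_le_regularizer hu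
  have h₄ := regularizer_nonpos hp
  unfold dualObjective
  linarith

/-- The `t`-th iterate of the saddle point solver. -/
noncomputable def solverIterate (D : ℝ) (K t : ℕ) : Point G ℝ :=
  (fun w => w + doubleOracle G D K (saddleMap G w))^[t] (0, fun _ => 1 / (G.edgeFinset.card : ℝ))

lemma solverIterate_succ (D : ℝ) (K t : ℕ) :
    solverIterate (G := G) D K (t + 1) = solverIterate D K t +
      doubleOracle G D K (saddleMap G (solverIterate D K t)) :=
  Function.iterate_succ_apply' _ _ _

lemma solverIterate_fst_mem [Nonempty G.edgeSet] {D : ℝ} (hD : 0 < D) (K t : ℕ) :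
    (∀ d, (solverIterate (G := G) D K t).1 d ∈ Set.Icc (0 : ℝ) t) ∧
      ∀ u, load G (solverIterate D K t).1 u ≤ t * D := by
  induction t with
  | zero => exact ⟨fun d => by simp [solverIterate], fun u => by simp [solverIterate, load]⟩
  | succ t ih =>
    have hmem := (oracle_mem hD K (saddleMap G (solverIterate D K t) +
      (2 : ℝ) • saddleMap G (oracle G D K (saddleMap G (solverIterate D K t))))).1
    rw [solverIterate_succ]
    refine ⟨fun d => ⟨add_nonneg (ih.1 d).1 (hmem.1 d).1, ?_⟩, fun u => ?_⟩
    · push_cast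
      exact add_le_add (ih.1 d).2 (hmem.1 d).2
    · rw [Prod.fst_add, load_add]
      have := add_le_add (ih.2 u) (hmem.2 u)
      push_cast
      rw [add_mul, one_mul]
      exact this

lemma solverIterate_mem_mulSaddleBox [Nonempty G.edgeSet] {D : ℝ} (hD : 0 < D) (K t : ℕ) :
    solverIterate D K t ∈ mulSaddleBox G (t + 1) := by
  induction t with
  | zero =>
    refine ⟨fun d => by simp [solverIterate], fun e => by simp [solverIterate], ?_⟩
    have hm : (G.edgeFinset.card : ℝ) ≠ 0 := by
      rw [← card_edgeSet_eq]
      exact_mod_cast Fintype.card_ne_zero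
    simp only [solverIterate, Function.iterate_zero, id, Finset.sum_const, Finset.card_univ,
      nsmul_eq_mul, card_edgeSet_eq]
    simp [hm]
  | succ t ih =>
    rw [solverIterate_succ]
    push_cast
    exact mulSaddleBox_add ih (saddleDomain_subset_mulSaddleBox D (oracle_mem hD K _))

/-- The potential `max_p (⟨p, A w⟩ - φ(p))` grows by at most the oracle error per update. -/
lemma dualObjective_solverIterate_le [Nonempty G.edgeSet] {D δ : ℝ} (hD : 0 < D) {K T : ℕ}
    (hδ : (2 / 3) ^ (K + 1) * (4 * ((T : ℝ) + 3) + regularizerRange G) ≤ δ) {t : ℕ} (ht : t ≤ T)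
    {p : Point G ℝ} (hp : p ∈ saddleDomain G D) :
    dualObjective (saddleMap G (solverIterate D K t)) p ≤ 2 + regularizerRange G + t * δ := by
  induction t generalizing p with
  | zero =>
    have h₁ := (abs_le.1 (abs_pairing_saddleMap_le hp (solverIterate_mem_mulSaddleBox hD K 0))).2
    have h₂ := neg_range_le_regularizer hp
    unfold dualObjective
    push_cast at h₁ ⊢
    linarith
  | succ t ih =>
    have ht' : (t : ℝ) + 1 ≤ T := by exact_mod_cast ht
    set w := solverIterate (G := G) D K t with hw
    set a := oracle G D K (saddleMap G w) with ha
    have haK : a ∈ saddleDomain G D := oracle_mem hD K _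
    have hwbox : w ∈ mulSaddleBox G (t + 1) := solverIterate_mem_mulSaddleBox hD K t
    have hx : saddleMap G w + (2 : ℝ) • saddleMap G a = saddleMap G (w + a + a) := by
      rw [saddleMap_add, saddleMap_add, two_smul, add_assoc]
    have approx : ∀ τ : ℝ, τ ≤ T + 3 → ∀ v ∈ mulSaddleBox G τ, ∀ q ∈ saddleDomain G D,
        dualObjective (saddleMap G v) q ≤
          dualObjective (saddleMap G v) (oracle G D K (saddleMap G v)) + δ := by
      intro τ hτ v hv q hq
      refine (dualObjective_le_oracle_add hD K (saddleMap G v)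
        (fun u hu p hp => dualObjective_saddleMap_sub_le hu hp hv) hq).trans ?_
      have : (2 / 3 : ℝ) ^ (K + 1) * (4 * τ + regularizerRange G) ≤
          (2 / 3) ^ (K + 1) * (4 * ((T : ℝ) + 3) + regularizerRange G) := by gcongr
      linarith
    have habox := saddleDomain_subset_mulSaddleBox D haK
    have h := dualObjective_update_le (x := saddleMap G w) (δ := δ)
      (fun q hq => ih (by omega) hq) haK (approx _ (by linarith) w hwbox)
      (oracle_mem hD K (saddleMap G w + (2 : ℝ) • saddleMap G a))
      (by
        rw [hx]
        exact approx _ (by linarith) _ (mulSaddleBox_add (mulSaddleBox_add hwbox habox) habox))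
      hp
    rw [solverIterate_succ, saddleMap_add]
    push_cast
    rw [add_mul, one_mul, ← add_assoc]
    exact h

lemma saddleSolver_eq (D : ℝ) (T K : ℕ) :
    saddleSolver G D T K = (1 / (T : ℝ)) • (solverIterate (G := G) D K T).1 := by
  funext d
  simp [saddleSolver, solverIterate, div_eq_inv_mul]

lemma saddleSolver_mem [Nonempty G.edgeSet] {D : ℝ} (hD : 0 < D) {T : ℕ} (hT : 0 < T) (K : ℕ) :
    saddleSolver G D T K ∈ capacityPolytope G D := by
  have hT' : (0 : ℝ) < T := by exact_mod_cast hT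
  obtain ⟨h₁, h₂⟩ := solverIterate_fst_mem (G := G) hD K T
  rw [saddleSolver_eq]
  refine ⟨fun d => ?_, fun u => ?_⟩
  · rw [Pi.smul_apply, smul_eq_mul, one_div_mul_eq_div]
    exact ⟨div_nonneg (h₁ d).1 hT'.le, (div_le_one hT').2 (h₁ d).2⟩
  · rw [load_smul, one_div_mul_eq_div, div_le_iff₀ hT', mul_comm]
    exact h₂ u

/-- If the feasibility problem for `D` has a solution, the solver finds an approximate one. -/
lemma saddleSolver_covers [Nonempty G.edgeSet] {D δ : ℝ} (hD : 0 < D) {K T : ℕ} (hT : 0 < T)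
    (hδ : (2 / 3) ^ (K + 1) * (4 * ((T : ℝ) + 3) + regularizerRange G) ≤ δ)
    {z : G.Dart → ℝ} (hz : z ∈ capacityPolytope G D) (hcov : ∀ d : G.Dart, 1 ≤ z d + z d.symm)
    (d : G.Dart) :
    1 - ((2 + regularizerRange G) / T + δ) ≤
      saddleSolver G D T K d + saddleSolver G D T K d.symm := by
  have hT' : (0 : ℝ) < T := by exact_mod_cast hT
  set w := solverIterate (G := G) D K T with hw
  have hbox : w ∈ mulSaddleBox G (T + 1) := solverIterate_mem_mulSaddleBox hD K T
  -- Test the potential bound against `z` and the point mass at the edge of `d`.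
  have hp : (z, Pi.single (edgeOf d) 1) ∈ saddleDomain G D := ⟨hz, single_mem_stdSimplex ℝ _⟩
  have h := dualObjective_solverIterate_le hD hδ le_rfl hp
  have hφ := regularizer_nonpos hp
  have h₁ : (T : ℝ) + 1 ≤ ∑ d', z d' * w.2 (edgeOf d') := by
    simp only [mul_comm (z _)]
    rw [← hbox.2.2, ← sum_edges_mul_sum_darts]
    refine Finset.sum_le_sum fun e _ => le_mul_of_one_le_right (hbox.2.1 e) ?_
    obtain ⟨d', rfl⟩ := edgeOf_surjective e
    exact (hcov d').trans_eq (sum_darts_of_edge z d').symm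
  have h₂ : ∑ d', (Pi.single (edgeOf d) 1 : G.edgeSet → ℝ) (edgeOf d') * w.1 d' =
      w.1 d + w.1 d.symm := by
    rw [← sum_edges_mul_sum_darts, Finset.sum_eq_single (edgeOf d)]
    · rw [Pi.single_eq_same, one_mul]
      exact sum_darts_of_edge w.1 d
    · intro e _ he
      rw [Pi.single_eq_of_ne he, zero_mul]
    · simp
  rw [dualObjective, pairing_saddleMap, Finset.sum_sub_distrib, h₂] at h
  rw [saddleSolver_eq]
  simp only [Pi.smul_apply, smul_eq_mul]
  rw [← mul_add, one_div_mul_eq_div, le_div_iff₀ hT', sub_mul, add_mul, div_mul_cancel₀ _ hT'.ne']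
  linarith

end Solver

section Duality

variable {V : Type*} [Fintype V] [DecidableEq V] {G : SimpleGraph V} [DecidableRel G.Adj]

/-! ### The value of the linear program -/

lemma exists_isGreatest_densities [Nonempty V] : ∃ ρ, IsGreatest (densities G) ρ := by
  have hfin : (densities G).Finite := by
    refine (Set.finite_range fun S : Finset V =>
      (inducedEdgeCount G S : ℝ) / (S.card : ℝ)).subset ?_
    rintro ρ ⟨S, -, rfl⟩
    exact ⟨S, rfl⟩
  have hne : (densities G).Nonempty := ⟨_, Finset.univ, Finset.univ_nonempty, rfl⟩
  exact ⟨_, hne.csSup_mem hfin, fun ρ hρ => le_csSup hfin.bddAbove hρ⟩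

lemma sum_darts_within_eq_sum_edges (S : Finset V) (z : G.Dart → ℝ) :
    ∑ d : G.Dart with d.fst ∈ S ∧ d.snd ∈ S, z d =
      ∑ e ∈ G.edgeFinset.filter (fun e => ∀ u ∈ e, u ∈ S),
        ∑ d : G.Dart with d.edge = e, z d := by
  rw [← Finset.sum_fiberwise_of_maps_to (g := fun d : G.Dart => d.edge)
    (t := G.edgeFinset.filter fun e => ∀ u ∈ e, u ∈ S)]
  · refine Finset.sum_congr rfl fun e he => Finset.sum_congr ?_ fun _ _ => rfl
    ext d
    simp only [Finset.mem_filter, Finset.mem_univ, true_and, and_iff_right_iff_imp]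
    rintro rfl
    have h := (Finset.mem_filter.1 he).2
    exact ⟨h _ (Sym2.mem_mk_left _ _), h _ (Sym2.mem_mk_right _ _)⟩
  · intro d hd
    have h := (Finset.mem_filter.1 hd).2
    refine Finset.mem_filter.2 ⟨SimpleGraph.mem_edgeFinset.2 d.edge_mem, fun u hu => ?_⟩
    rcases Sym2.mem_iff.1 (show u ∈ s(d.fst, d.snd) from hu) with rfl | rfl
    exacts [h.1, h.2]

lemma sum_load_eq_sum_darts (S : Finset V) (z : G.Dart → ℝ) :
    ∑ u ∈ S, load G z u = ∑ d : G.Dart with d.fst ∈ S, z d := by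
  rw [← Finset.sum_fiberwise_of_maps_to (g := fun d : G.Dart => d.fst) (t := S)
    (fun d hd => (Finset.mem_filter.1 hd).2)]
  refine Finset.sum_congr rfl fun u hu => Finset.sum_congr ?_ fun _ _ => rfl
  ext d
  simp only [Finset.mem_filter, Finset.mem_univ, true_and, iff_and_self]
  rintro rfl
  exact hu

/-- Weak duality. -/
lemma density_le_of_lpFeasible {z : G.Dart → ℝ} {D : ℝ} (h : LPFeasible G z D) {ρ : ℝ}
    (hρ : ρ ∈ densities G) : ρ ≤ D := by
  obtain ⟨S, hS, rfl⟩ := hρ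
  rw [div_le_iff₀ (by exact_mod_cast hS.card_pos)]
  calc (inducedEdgeCount G S : ℝ)
      = ∑ e ∈ G.edgeFinset.filter (fun e => ∀ u ∈ e, u ∈ S), (1 : ℝ) := by
        simp [inducedEdgeCount]
    _ ≤ ∑ e ∈ G.edgeFinset.filter (fun e => ∀ u ∈ e, u ∈ S),
          ∑ d : G.Dart with d.edge = e, z d := by
        refine Finset.sum_le_sum fun e he => ?_
        obtain ⟨d, hd⟩ := edgeOf_surjective
          (⟨e, SimpleGraph.mem_edgeFinset.1 (Finset.mem_filter.1 he).1⟩ : G.edgeSet)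
        obtain rfl : d.edge = e := congrArg Subtype.val hd
        exact (h.2.1 d).trans_eq (sum_darts_of_edge z d).symm
    _ = ∑ d : G.Dart with d.fst ∈ S ∧ d.snd ∈ S, z d := (sum_darts_within_eq_sum_edges S z).symm
    _ ≤ ∑ d : G.Dart with d.fst ∈ S, z d :=
        Finset.sum_le_sum_of_subset_of_nonneg
          (fun d hd => Finset.mem_filter.2 ⟨Finset.mem_univ _, (Finset.mem_filter.1 hd).2.1⟩)
          fun d _ _ => (h.2.2 d).1
    _ = ∑ u ∈ S, load G z u := (sum_load_eq_sum_darts S z).symm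
    _ ≤ ∑ u ∈ S, D := Finset.sum_le_sum fun u _ => h.1 u
    _ = D * S.card := by rw [Finset.sum_const, nsmul_eq_mul, mul_comm]

variable (G) in
/-- The polytope of fractional orientations: every edge distributes one unit of load among its two
endpoints. -/
def fractionalOrientations : Set (G.Dart → ℝ) :=
  {z | (∀ d, z d ∈ Set.Icc (0 : ℝ) 1) ∧ ∀ d, z d + z d.symm = 1}

lemma isCompact_fractionalOrientations : IsCompact (fractionalOrientations G) := by
  have h : IsCompact (Set.univ.pi fun _ : G.Dart => Set.Icc (0 : ℝ) 1) :=
    isCompact_univ_pi fun _ => isCompact_Icc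
  refine h.of_isClosed_subset ?_ fun z hz d _ => hz.1 d
  refine IsClosed.inter ?_ ?_
  · show IsClosed {z : G.Dart → ℝ | ∀ d, z d ∈ Set.Icc (0 : ℝ) 1}
    rw [Set.ofPred_forall]
    exact isClosed_iInter fun d => isClosed_Icc.preimage (continuous_apply d)
  · show IsClosed {z : G.Dart → ℝ | ∀ d : G.Dart, z d + z d.symm = 1}
    rw [Set.ofPred_forall]
    exact isClosed_iInter fun d =>
      isClosed_eq ((continuous_apply d).add (continuous_apply d.symm)) continuous_const

/-- Moving the amount `t` of load from the tail to the head of the dart `d`. -/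
lemma load_shift (z : G.Dart → ℝ) (d : G.Dart) (t : ℝ) (u : V) :
    load G (z - Pi.single d t + Pi.single d.symm t) u =
      load G z u + t * ((if u = d.snd then 1 else 0) - if u = d.fst then 1 else 0) := by
  have h : ∀ d' : G.Dart, load G (Pi.single d' t) u = if u = d'.fst then t else 0 := by
    intro d'
    rw [load, Finset.sum_filter, Finset.sum_eq_single d']
    · simp [eq_comm]
    · intro b _ hb
      simp [Pi.single_eq_of_ne hb]
    · simp
  have hsub : load G (z - Pi.single d t) u = load G z u - load G (Pi.single d t) u :=
    Finset.sum_sub_distrib _ _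
  rw [load_add, hsub, h, h]
  show _ - _ + (if u = d.snd then t else 0) = _
  split_ifs <;> ring

/-- An orientation that minimizes the sum of the squared loads sends load only along darts whose
tail has at most the load of the head. -/
lemma load_fst_le_load_snd {z : G.Dart → ℝ} (hz : z ∈ fractionalOrientations G)
    (hmin : IsMinOn (fun z => ∑ u, load G z u ^ 2) (fractionalOrientations G) z) {d : G.Dart}
    (hd : 0 < z d) : load G z d.fst ≤ load G z d.snd := by
  by_contra! hlt
  -- Moving `t` along `d` changes the sum of squares by `2 t (t - (load fst - load snd))`.
  set g := load G z d.fst - load G z d.snd with hg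
  set t := min (z d) (g / 2) with ht
  have ht0 : 0 < t := lt_min hd (by linarith)
  have htz : t ≤ z d := min_le_left _ _
  have htg : t ≤ g / 2 := min_le_right _ _
  have hne : d.symm ≠ d := d.symm_ne
  have hmem : z - Pi.single d t + Pi.single d.symm t ∈ fractionalOrientations G := by
    have hsum : ∀ d', (z - Pi.single d t + Pi.single d.symm t : G.Dart → ℝ) d' +
        (z - Pi.single d t + Pi.single d.symm t : G.Dart → ℝ) d'.symm = 1 := by
      intro d'
      have h := hz.2 d'
      simp only [Pi.add_apply, Pi.sub_apply, Pi.single_apply]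
      have e₁ : d'.symm = d ↔ d' = d.symm := by
        constructor <;> rintro rfl <;> simp
      have e₂ : d'.symm = d.symm ↔ d' = d := by
        constructor
        · intro h
          simpa using congrArg SimpleGraph.Dart.symm h
        · rintro rfl; rfl
      simp only [e₁, e₂]
      linarith
    have hnonneg : ∀ d', 0 ≤ (z - Pi.single d t + Pi.single d.symm t : G.Dart → ℝ) d' := by
      intro d'
      simp only [Pi.add_apply, Pi.sub_apply, Pi.single_apply]
      have := (hz.1 d').1
      by_cases h : d' = d
      · subst h
        simp only [if_true, if_neg hne.symm]
        linarith
      · rw [if_neg h]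
        split_ifs <;> linarith
    exact ⟨fun d' => ⟨hnonneg d', by linarith [hsum d', hnonneg d'.symm]⟩, hsum⟩
  have h : ∑ u, load G z u ^ 2 ≤
      ∑ u, load G (z - Pi.single d t + Pi.single d.symm t) u ^ 2 := hmin hmem
  have huv : d.fst ≠ d.snd := d.adj.ne
  have hdelta : ∀ u, load G (z - Pi.single d t + Pi.single d.symm t) u ^ 2 =
      load G z u ^ 2 + (if u = d.snd then 2 * t * load G z u + t ^ 2 else 0) +
        (if u = d.fst then -(2 * t * load G z u) + t ^ 2 else 0) := by
    intro u
    rw [load_shift]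
    by_cases h₁ : u = d.snd
    · have h₂ : u ≠ d.fst := fun h => huv (h.symm.trans h₁)
      simp only [if_pos h₁, if_neg h₂]
      ring
    · simp only [if_neg h₁]
      split_ifs <;> ring
  simp only [hdelta, Finset.sum_add_distrib, Finset.sum_ite_eq', Finset.mem_univ, if_true] at h
  nlinarith

/-- The linear program has a solution whose value is the density of some set of vertices, namely of
the set of all vertices of maximal load. -/
lemma exists_lpFeasible_mem_densities [Nonempty V] :
    ∃ (z : G.Dart → ℝ) (ρ : ℝ), ρ ∈ densities G ∧ LPFeasible G z ρ := by
  have hne : (fractionalOrientations G).Nonempty :=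
    ⟨fun _ => 1 / 2, fun d => by norm_num, fun d => by norm_num⟩
  have hcont : Continuous fun z : G.Dart → ℝ => ∑ u, load G z u ^ 2 := by
    unfold load
    fun_prop
  obtain ⟨z, hz, hmin⟩ := isCompact_fractionalOrientations.exists_isMinOn hne hcont.continuousOn
  obtain ⟨v, -, hv⟩ := Finset.exists_max_image Finset.univ (load G z) Finset.univ_nonempty
  set S : Finset V := Finset.univ.filter fun u => load G z u = load G z v with hS
  have hSne : S.Nonempty := ⟨v, by simp [hS]⟩
  refine ⟨z, load G z v, ⟨S, hSne, ?_⟩, fun u => hv u (Finset.mem_univ u),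
    fun d => (hz.2 d).ge, fun d => hz.1 d⟩
  rw [eq_div_iff (by exact_mod_cast hSne.card_pos.ne')]
  calc load G z v * S.card = ∑ u ∈ S, load G z u := by
        rw [Finset.sum_congr rfl fun u hu => (Finset.mem_filter.1 hu).2, Finset.sum_const,
          nsmul_eq_mul, mul_comm]
    _ = ∑ d : G.Dart with d.fst ∈ S, z d := sum_load_eq_sum_darts S z
    _ = ∑ d : G.Dart with d.fst ∈ S ∧ d.snd ∈ S, z d := by
        symm
        refine Finset.sum_subset
          (fun d hd => Finset.mem_filter.2 ⟨Finset.mem_univ _, (Finset.mem_filter.1 hd).2.1⟩) ?_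
        intro d hd hd'
        have hfst : d.fst ∈ S := (Finset.mem_filter.1 hd).2
        refine le_antisymm (not_lt.1 fun hpos => hd' ?_) (hz.1 d).1
        have h₁ := load_fst_le_load_snd hz hmin hpos
        rw [(Finset.mem_filter.1 hfst).2] at h₁
        exact Finset.mem_filter.2 ⟨Finset.mem_univ _, hfst, Finset.mem_filter.2
          ⟨Finset.mem_univ _, le_antisymm (hv _ (Finset.mem_univ _)) h₁⟩⟩
    _ = ∑ e ∈ G.edgeFinset.filter (fun e => ∀ u ∈ e, u ∈ S),
          ∑ d : G.Dart with d.edge = e, z d := sum_darts_within_eq_sum_edges S z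
    _ = ∑ e ∈ G.edgeFinset.filter (fun e => ∀ u ∈ e, u ∈ S), (1 : ℝ) := by
        refine Finset.sum_congr rfl fun e he => ?_
        obtain ⟨d, hd⟩ := edgeOf_surjective
          (⟨e, SimpleGraph.mem_edgeFinset.1 (Finset.mem_filter.1 he).1⟩ : G.edgeSet)
        obtain rfl : d.edge = e := congrArg Subtype.val hd
        rw [sum_darts_of_edge, hz.2]
    _ = inducedEdgeCount G S := by simp [inducedEdgeCount]

/-- Strong duality: the optimal value of the linear program is attained and equals the maximal
density. -/
lemma isLeast_lp_of_isGreatest_densities [Nonempty V] {ρ : ℝ} (hρ : IsGreatest (densities G) ρ) :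
    IsLeast {D : ℝ | ∃ z : G.Dart → ℝ, LPFeasible G z D} ρ := by
  obtain ⟨z, ρ', hρ', hz⟩ := exists_lpFeasible_mem_densities (G := G)
  have h : ρ = ρ' := le_antisymm (density_le_of_lpFeasible hz hρ.1) (hρ.2 hρ')
  exact ⟨⟨z, h ▸ hz⟩, fun D ⟨z', hz'⟩ => density_le_of_lpFeasible hz' hρ.1⟩

lemma half_le_of_isGreatest_densities {ρ : ℝ} (hρ : IsGreatest (densities G) ρ) (d : G.Dart) :
    1 / 2 ≤ ρ := by
  refine le_trans ?_ (hρ.2 ⟨{d.fst, d.snd}, ⟨d.fst, by simp⟩, rfl⟩)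
  rw [Finset.card_pair d.adj.ne]
  have : 1 ≤ inducedEdgeCount G {d.fst, d.snd} := by
    refine Finset.card_pos.2 ⟨d.edge, Finset.mem_filter.2
      ⟨SimpleGraph.mem_edgeFinset.2 d.edge_mem, fun u hu => ?_⟩⟩
    rcases Sym2.mem_iff.1 (show u ∈ s(d.fst, d.snd) from hu) with rfl | rfl <;> simp
  have h : (1 : ℝ) ≤ inducedEdgeCount G {d.fst, d.snd} := by exact_mod_cast this
  push_cast
  linarith

end Duality

section Search

variable {V : Type*} [Fintype V] [DecidableEq V] {G : SimpleGraph V} [DecidableRel G.Adj]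

/-! ### The binary search -/

/-- The invariant of the binary search after `k` steps: `ρ` is the optimal value. -/
structure SearchInvariant (ρ ε' : ℝ) (k : ℕ) (σ : SearchState G ℝ) : Prop where
  lo_nonneg : 0 ≤ σ.lo
  lo_le : σ.lo ≤ ρ
  hi_pos : 0 < σ.hi
  width : σ.hi - σ.lo = (G.maxDegree : ℝ) / 2 ^ k
  mem : σ.z ∈ capacityPolytope G σ.hi
  covers : ∀ d : G.Dart, 1 - ε' ≤ σ.z d + σ.z d.symm

lemma searchInvariant_init [Nonempty G.edgeSet] {ρ ε' : ℝ} (hρ : 0 ≤ ρ) (hε' : 0 ≤ ε') :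
    SearchInvariant (G := G) ρ ε' 0 ⟨0, (G.maxDegree : ℝ), fun _ => 1⟩ where
  lo_nonneg := le_rfl
  lo_le := hρ
  hi_pos := by
    obtain ⟨d, -⟩ := edgeOf_surjective (Classical.arbitrary G.edgeSet)
    have h : 0 < G.degree d.fst := (G.degree_pos_iff_exists_adj _).2 ⟨_, d.adj⟩
    exact Nat.cast_pos.2 (h.trans_le (G.degree_le_maxDegree _))
  width := by simp
  mem := ⟨fun _ => by simp, fun u => by
    have h : (Finset.univ.filter fun d : G.Dart => d.fst = u).card = G.degree u :=
      G.dart_fst_fiber_card_eq_degree u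
    simp only [load, Finset.sum_const, nsmul_eq_mul, mul_one, h]
    exact_mod_cast G.degree_le_maxDegree u⟩
  covers := fun _ => by norm_num; linarith

lemma SearchInvariant.step [Nonempty G.edgeSet] {ρ ε' δ : ℝ} {T K k : ℕ} {σ : SearchState G ℝ}
    (h : SearchInvariant ρ ε' k σ) {zopt : G.Dart → ℝ} (hopt : LPFeasible G zopt ρ) (hT : 0 < T)
    (hδ : (2 / 3) ^ (K + 1) * (4 * ((T : ℝ) + 3) + regularizerRange G) ≤ δ)
    (hε' : (2 + regularizerRange G) / T + δ ≤ ε') :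
    SearchInvariant ρ ε' (k + 1) (searchStep G ε' T K σ) := by
  have hmid : 0 < (σ.lo + σ.hi) / 2 := by linarith [h.lo_nonneg, h.hi_pos]
  have hwidth : (G.maxDegree : ℝ) / 2 ^ (k + 1) = (σ.hi - σ.lo) / 2 := by
    rw [h.width, pow_succ, div_div]
  by_cases hacc : ∀ d : G.Dart, 1 - ε' ≤ saddleSolver G ((σ.lo + σ.hi) / 2) T K d +
      saddleSolver G ((σ.lo + σ.hi) / 2) T K d.symm
  · rw [show searchStep G ε' T K σ = ⟨σ.lo, (σ.lo + σ.hi) / 2,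
      saddleSolver G ((σ.lo + σ.hi) / 2) T K⟩ from if_pos hacc]
    exact ⟨h.lo_nonneg, h.lo_le, hmid, by rw [hwidth]; ring, saddleSolver_mem hmid hT K, hacc⟩
  · rw [show searchStep G ε' T K σ = ⟨(σ.lo + σ.hi) / 2, σ.hi, σ.z⟩ from if_neg hacc]
    refine ⟨hmid.le, ?_, h.hi_pos, by rw [hwidth]; ring, h.mem, h.covers⟩
    -- A midpoint above the optimal value would have been accepted.
    by_contra! hlt
    refine hacc fun d => le_trans (by linarith) (saddleSolver_covers hmid hT hδ (z := zopt)
      ⟨fun d => hopt.2.2 d, fun u => (hopt.1 u).trans hlt.le⟩ hopt.2.1 d)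

/-- The outcome of the binary search: an almost covering solution whose loads exceed the optimal
value by at most `Δ / 2^N`. -/
lemma binarySearch_spec [Nonempty G.edgeSet] {ρ ε' δ : ℝ} {T K : ℕ} (N : ℕ) (hρ : 0 ≤ ρ)
    {zopt : G.Dart → ℝ} (hopt : LPFeasible G zopt ρ) (hT : 0 < T) (hε'0 : 0 ≤ ε')
    (hδ : (2 / 3) ^ (K + 1) * (4 * ((T : ℝ) + 3) + regularizerRange G) ≤ δ)
    (hε' : (2 + regularizerRange G) / T + δ ≤ ε') :
    binarySearch G ε' T K N ∈ capacityPolytope G (ρ + (G.maxDegree : ℝ) / 2 ^ N) ∧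
      ∀ d : G.Dart, 1 - ε' ≤ binarySearch G ε' T K N d + binarySearch G ε' T K N d.symm := by
  have h : SearchInvariant ρ ε' N
      ((searchStep G ε' T K)^[N] ⟨0, (G.maxDegree : ℝ), fun _ => 1⟩) := by
    induction N with
    | zero => exact searchInvariant_init hρ hε'0
    | succ N ih =>
      rw [Function.iterate_succ_apply']
      exact ih.step hopt hT hδ hε'
  exact ⟨⟨h.mem.1, fun u => (h.mem.2 u).trans (by linarith [h.width, h.lo_le])⟩, h.covers⟩

/-- Rescaling turns an almost covering solution into a feasible one and increases the loads by a
factor of at most `1 / (1 - ε')`. -/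
lemma normalize_spec {z : G.Dart → ℝ} {D ε' : ℝ} (hε' : ε' < 1) (hz : z ∈ capacityPolytope G D)
    (hcov : ∀ d : G.Dart, 1 - ε' ≤ z d + z d.symm) :
    (∀ u, load G (normalize G z) u ≤ D / (1 - ε')) ∧
      (∀ d, normalize G z d + normalize G z d.symm = 1) ∧
      ∀ d, 0 ≤ normalize G z d ∧ normalize G z d ≤ 1 := by
  have hpos : ∀ d : G.Dart, 0 < z d + z d.symm := fun d => by linarith [hcov d]
  refine ⟨fun u => ?_, fun d => ?_, fun d => ⟨div_nonneg (hz.1 d).1 (hpos d).le,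
    (div_le_one (hpos d)).2 (by linarith [(hz.1 d.symm).1])⟩⟩
  · calc load G (normalize G z) u ≤ load G z u / (1 - ε') := by
          rw [load, load, Finset.sum_div]
          refine Finset.sum_le_sum fun d _ => ?_
          exact div_le_div_of_nonneg_left (hz.1 d).1 (by linarith) (hcov d)
      _ ≤ D / (1 - ε') := by
          have : 0 < 1 - ε' := by linarith
          gcongr
          exact hz.2 u
  · simp only [normalize, SimpleGraph.Dart.symm_symm]
    rw [add_comm (z d.symm) (z d), ← add_div, div_self (hpos d).ne']

lemma isGreatest_fold_load [Nonempty V] {z : G.Dart → ℝ} (hz : ∀ d, 0 ≤ z d) :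
    IsGreatest (Set.range (load G z)) (Finset.univ.fold max 0 (load G z)) := by
  constructor
  · obtain ⟨v, -, hv⟩ := Finset.exists_max_image Finset.univ (load G z) Finset.univ_nonempty
    exact ⟨v, le_antisymm ((Finset.le_fold_max _).2 (Or.inr ⟨v, Finset.mem_univ v, le_rfl⟩))
      ((Finset.fold_max_le _).2 ⟨load_nonneg hz v, hv⟩)⟩
  · rintro _ ⟨u, rfl⟩
    exact (Finset.le_fold_max _).2 (Or.inr ⟨u, Finset.mem_univ u, le_rfl⟩)

/-! ### The iteration counts -/

/-- The accuracy reached by the prescribed numbers of iterations.  With `X = (m + 1) / ε`, the factor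
`(2/3)^K` is at most `X^{-30}`, whereas the objective of the oracle varies by `O(X)`. -/
lemma iteration_bounds [Nonempty G.edgeSet] {ε : ℝ} (hε0 : 0 < ε) (hε1 : ε < 1) :
    0 < outerIterations G 1000 ε ∧
      (2 + regularizerRange G) / (outerIterations G 1000 ε : ℝ) ≤ ε / 6 ∧
      (2 / 3) ^ (innerIterations G 1000 ε + 1) *
        (4 * ((outerIterations G 1000 ε : ℝ) + 3) + regularizerRange G) ≤ ε / 6 ∧
      (G.maxDegree : ℝ) / 2 ^ innerIterations G 1000 ε ≤ ε / 12 := by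
  have hm : (1 : ℝ) ≤ G.edgeFinset.card := by
    rw [← card_edgeSet_eq]
    exact Nat.one_le_cast.2 Fintype.card_pos
  have hΔ : (G.maxDegree : ℝ) ≤ G.edgeFinset.card := by
    exact Nat.cast_le.2 (G.maxDegree_le_of_forall_degree_le _
      fun v => G.degree_le_card_edgeFinset v)
  have hTle : ((1000 : ℕ) : ℝ) * Real.log ((G.edgeFinset.card : ℝ) + 1) / ε ≤
      (outerIterations G 1000 ε : ℝ) := Nat.le_ceil _
  have hTlt : (outerIterations G 1000 ε : ℝ) <
      ((1000 : ℕ) : ℝ) * Real.log ((G.edgeFinset.card : ℝ) + 1) / ε + 1 := by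
    refine Nat.ceil_lt_add_one (div_nonneg (mul_nonneg (Nat.cast_nonneg _)
      (Real.log_nonneg ?_)) hε0.le)
    linarith
  have hK : ((1000 : ℕ) : ℝ) * Real.log (((G.edgeFinset.card : ℝ) + 1) / ε) ≤
      (innerIterations G 1000 ε : ℝ) := Nat.le_ceil _
  have hR : regularizerRange G = 6 * √3 * (2 + 6 * Real.log (G.edgeFinset.card : ℝ)) := rfl
  set T := outerIterations G 1000 ε
  set K := innerIterations G 1000 ε
  set m : ℝ := (G.edgeFinset.card : ℝ)
  set ℓ := Real.log (m + 1) with hℓ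
  set X := (m + 1) / ε with hX
  push_cast at hTle hTlt hK
  have hεX : ε * X = m + 1 := mul_div_cancel₀ _ hε0.ne'
  have hX2 : m + 1 ≤ X := (le_div_iff₀ hε0).2 (by nlinarith)
  have hℓ0 : 1 / 2 ≤ ℓ := by
    have h₁ : Real.log 2 ≤ ℓ := Real.log_le_log (by norm_num) (by linarith)
    linarith [Real.log_two_gt_d9]
  have hℓm : ℓ ≤ m := by linarith [Real.log_le_sub_one_of_pos (show 0 < m + 1 by linarith)]
  have hlogm : Real.log m ≤ ℓ := Real.log_le_log (by linarith) (by linarith)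
  have hlogm0 : 0 ≤ Real.log m := Real.log_nonneg hm
  have hsqrt : √3 ≤ 7 / 4 := Real.sqrt_le_iff.2 ⟨by norm_num, by norm_num⟩
  have hRle : regularizerRange G ≤ 21 + 63 * ℓ := by
    rw [hR]
    calc 6 * √3 * (2 + 6 * Real.log m) ≤ 6 * (7 / 4) * (2 + 6 * ℓ) := by gcongr
      _ = 21 + 63 * ℓ := by ring
  have hT0 : (0 : ℝ) < T := lt_of_lt_of_le (div_pos (by linarith) hε0) hTle
  have hdecay : (2 / 3 : ℝ) ^ K * (5000 * X) ≤ ε / 12 := by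
    have hXpos : 0 < X := by linarith
    have h₁ : (2 / 3 : ℝ) ^ K ≤ (X ^ 30)⁻¹ := by
      have hlogX : 0 ≤ Real.log X := Real.log_nonneg (by linarith)
      calc (2 / 3 : ℝ) ^ K ≤ Real.exp (-(1 / 3)) ^ K := by
            gcongr
            linarith [Real.add_one_le_exp (-(1 / 3 : ℝ))]
        _ = Real.exp (K * -(1 / 3)) := (Real.exp_nat_mul _ _).symm
        _ ≤ Real.exp (-((30 : ℕ) * Real.log X)) := by
            refine Real.exp_le_exp.2 ?_
            push_cast
            linarith
        _ = (X ^ 30)⁻¹ := by rw [Real.exp_neg, Real.exp_nat_mul, Real.exp_log hXpos]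
    have h₂ : (2 : ℝ) ^ 28 ≤ X ^ 28 := by
      gcongr
      linarith
    have h₃ : 1 ≤ ε * X := by linarith
    calc (2 / 3 : ℝ) ^ K * (5000 * X) ≤ (X ^ 30)⁻¹ * (5000 * X) := by gcongr
      _ ≤ ε / 12 := by
          rw [inv_mul_le_iff₀ (by positivity)]
          have h₄ : 60000 * X ≤ X ^ 28 * X := by
            gcongr
            linarith
          have h₅ : X ^ 28 * X * 1 ≤ X ^ 28 * X * (ε * X) := by gcongr
          have h₆ : X ^ 28 * X * (ε * X) = ε * X ^ 30 := by ring
          linarith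
  refine ⟨by exact_mod_cast hT0, ?_, ?_, ?_⟩
  · rw [div_le_iff₀ hT0]
    have : 1000 * ℓ ≤ ε * T := by
      rw [div_le_iff₀ hε0] at hTle
      linarith
    linarith
  · have hℓε : ℓ / ε ≤ X := by
      rw [hX]
      gcongr
      linarith
    have hTX : (T : ℝ) ≤ 1000 * X + 1 := by
      rw [mul_div_assoc] at hTlt
      linarith
    calc (2 / 3 : ℝ) ^ (K + 1) * (4 * ((T : ℝ) + 3) + regularizerRange G)
        ≤ (2 / 3 : ℝ) ^ (K + 1) * (5000 * X) := by
          gcongr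
          linarith
      _ ≤ (2 / 3 : ℝ) ^ K * (5000 * X) := by
          have := mul_nonneg (pow_nonneg (show (0 : ℝ) ≤ 2 / 3 by norm_num) K)
            (show 0 ≤ 5000 * X by linarith)
          rw [pow_succ]
          linarith
      _ ≤ ε / 6 := by linarith
  · calc (G.maxDegree : ℝ) / 2 ^ K = (1 / 2 : ℝ) ^ K * G.maxDegree := by
          rw [one_div, inv_pow, div_eq_inv_mul]
      _ ≤ (2 / 3 : ℝ) ^ K * (5000 * X) := by
          gcongr ?_ ^ K * ?_
          · norm_num
          · linarith
      _ ≤ ε / 12 := hdecay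

/-! ### Correctness of the algorithm -/

/-- The algorithm with the constant `1000` in both iteration counts solves the linear program up to
the factor `1 + ε`. -/
lemma dualAlgorithm_spec [Nonempty V] {ε : ℝ} (hε0 : 0 < ε) (hε1 : ε < 1) :
    ∃ (z : G.Dart → ℝ) (Dtilde OPT : ℝ),
      dualAlgorithm G 1000 ε = (z, Dtilde) ∧
      IsGreatest (densities G) OPT ∧
      IsLeast {D : ℝ | ∃ z' : G.Dart → ℝ, LPFeasible G z' D} OPT ∧
      IsGreatest (Set.range (load G z)) Dtilde ∧
      (∀ d : G.Dart, 1 ≤ z d + z d.symm) ∧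
      (∀ d : G.Dart, 0 ≤ z d ∧ z d ≤ 1) ∧
      (1 - ε) * OPT ≤ Dtilde ∧ Dtilde ≤ (1 + ε) * OPT := by
  obtain ⟨ρ, hρ⟩ := exists_isGreatest_densities (G := G)
  have hLP := isLeast_lp_of_isGreatest_densities hρ
  have hρ0 : 0 ≤ ρ := le_trans (by positivity) (hρ.2 ⟨Finset.univ, Finset.univ_nonempty, rfl⟩)
  set z := (dualAlgorithm G 1000 ε).1
  suffices h : (∀ u, load G z u ≤ (1 + ε) * ρ) ∧ (∀ d : G.Dart, 1 ≤ z d + z d.symm) ∧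
      ∀ d : G.Dart, 0 ≤ z d ∧ z d ≤ 1 by
    obtain ⟨hload, hcov, hbox⟩ := h
    have hgreatest := isGreatest_fold_load fun d => (hbox d).1
    refine ⟨z, Finset.univ.fold max 0 (load G z), ρ, rfl, hρ, hLP, hgreatest, hcov, hbox, ?_, ?_⟩
    · have : ρ ≤ Finset.univ.fold max 0 (load G z) :=
        hLP.2 ⟨z, fun u => hgreatest.2 ⟨u, rfl⟩, hcov, hbox⟩
      nlinarith
    · obtain ⟨u, hu⟩ := hgreatest.1
      rw [← hu]
      exact hload u
  rcases isEmpty_or_nonempty G.edgeSet with hE | hE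
  · have : IsEmpty G.Dart := ⟨fun d => hE.false (edgeOf d)⟩
    refine ⟨fun u => ?_, fun d => isEmptyElim d, fun d => isEmptyElim d⟩
    rw [load, Finset.univ_eq_empty, Finset.filter_empty, Finset.sum_empty]
    positivity
  obtain ⟨zopt, hopt⟩ := hLP.1
  obtain ⟨hT, hM, hδ, hΔ⟩ := iteration_bounds (G := G) hε0 hε1
  obtain ⟨hmem, hcov⟩ := binarySearch_spec (innerIterations G 1000 ε) hρ0 hopt hT
    (ε' := ε / 3) (by linarith) hδ (by linarith)
  obtain ⟨hload, hsum, hbox⟩ := normalize_spec (by linarith) hmem hcov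
  refine ⟨fun u => (hload u).trans ?_, fun d => (hsum d).ge, hbox⟩
  obtain ⟨d, -⟩ := edgeOf_surjective (Classical.arbitrary G.edgeSet)
  have hhalf := half_le_of_isGreatest_densities hρ d
  rw [div_le_iff₀ (by linarith)]
  -- `Δ / 2^N ≤ ε / 12 ≤ (ε / 6) ρ` and `1 + ε / 6 ≤ (1 + ε) (1 - ε / 3)`.
  have h₁ : ε / 12 ≤ ε / 6 * ρ := by nlinarith
  have h₂ : (1 + ε / 6) * ρ ≤ (1 + ε) * (1 - ε / 3) * ρ := by
    gcongr
    nlinarith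
  linarith

end Search

end DensestDual

theorem mainTheorem4 :
    ∃ c : ℕ, ∀ (n : ℕ) (_hn : 1 ≤ n) (G : SimpleGraph (Fin n)) [DecidableRel G.Adj]
      (ε : ℝ) (_hε0 : 0 < ε) (_hε1 : ε < 1),
      ∃ (z : G.Dart → ℝ) (Dtilde OPT : ℝ),
        DensestDual.dualAlgorithm G c ε = (z, Dtilde) ∧
        IsGreatest (DensestDual.densities G) OPT ∧
        IsLeast {D : ℝ | ∃ z' : G.Dart → ℝ, DensestDual.LPFeasible G z' D} OPT ∧
        IsGreatest (Set.range (DensestDual.load G z)) Dtilde ∧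
        (∀ d : G.Dart, 1 ≤ z d + z d.symm) ∧
        (∀ d : G.Dart, 0 ≤ z d ∧ z d ≤ 1) ∧
        (1 - ε) * OPT ≤ Dtilde ∧ Dtilde ≤ (1 + ε) * OPT := by
  refine ⟨1000, fun n hn G _ ε hε0 hε1 => ?_⟩
  have : Nonempty (Fin n) := ⟨⟨0, hn⟩⟩
  exact DensestDual.dualAlgorithm_spec hε0 hε1
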